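/- Let $V,H$ be separable real Hilbert spaces with a dense, compact embedding $V\hookrightarrow H$, and let $V\hookrightarrow H\simeq H'\hookrightarrow V'$ be the resulting Gelfand triple, with $\langle\cdot,\cdot\rangle$ denoting the scalar product on $H$ and the duality pairing on $V'\times V$. Let $T>0$, $I=(0,T)$, and for a.e. $t\in I$ let $a(t;\cdot,\cdot)$ be a bilinear form on $V\times V$ such that $t\mapsto a(t;\eta,\zeta)$ is measurable for all $\eta,\zeta\in V$ and, for constants $M<\infty$ and $\alpha>0$ and a.e. $t\in I$, $|a(t;\eta,\zeta)|\le M\|\eta\|_V\|\zeta\|_V$ and $a(t;\eta,\eta)\ge\alpha\|\eta\|_V^2$ for all $\eta,\zeta\in V$. Put $Y:=L_2(I;V)$, $X:=L_2(I;V)\cap H^1(I;V')$, let $\gamma_t\colon X\to H$, $u\mapsto u(t)$, for $t\in[0,T]$, be the trace maps, i.e. the evaluations of the continuous representative, and define $$(Au)(v)=\int_I a(t;u(t),v(t))\,dt,\quad A_s=\tfrac12(A+A')\colon Y\to Y',\quad (Bw)(v)=\int_I\langle \tfrac{dw}{dt}(t),v(t)\rangle+a(t;w(t),v(t))\,dt,\quad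 C=B-A_s\colon X\to Y'.$$ Here a prime on an operator denotes the dual operator, and $\mathcal{L}\mathrm{is}(E,F)$ the boundedly invertible linear maps $E\to F$. Then: 1. $X$ embeds continuously into $C([0,T];H)$ (so that $\gamma_t$ is well defined and bounded) and $A_s\in\mathcal{L}\mathrm{is}(Y,Y')$. 2. The operator $C'A_s^{-1}C+A_s+\gamma_T'\gamma_T\colon X\to X'$ is self-adjoint, coercive, and in $\mathcal{L}\mathrm{is}(X,X')$. 3. $C'A_s^{-1}C+A_s+\gamma_T'\gamma_T=B'A_s^{-1}B+\gamma_0'\gamma_0$. 4. The block operator $\begin{bmatrix}A_s&C\\C'&-(A_s+\gamma_T'\gamma_T)\end{bmatrix}$ is self-adjoint and in $\mathcal{L}\mathrm{is}(Y\times X,Y'\times X')$. 5. For every $g\in Y'$ and $u_0\in H$, the equation $$(C'A_s^{-1}C+A_s+\gamma_T'\gamma_T)u=(\mathrm{Id}+C'A_s^{-1})g+\gamma_0'u_0$$ has exactly one solution $u\in X$, and $u\in X$ solves it if and only if $Bu=g$ and $\gamma_0u=u_0$. 6. For every $g\in Y'$ and $u_0\in H$, the system $$\begin{bmatrix}A_s&C\\C'&-(A_s+\gamma_T'\gamma_T)\end{bmatrix}\begin{bmatrix}\lambda\\u\end{bmatrix}=\begin{bmatrix}g\\-(g+\gamma_0'u_0)\end{bmatrix}$$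 has exactly one solution $(\lambda,u)\in Y\times X$, and $(\lambda,u)$ solves it if and only if $\lambda=u$, $Bu=g$ and $\gamma_0u=u_0$. -/

import Mathlib

open MeasureTheory Set Filter Topology
open scoped ContDiff

noncomputable section

namespace Parabolic

/-! ### Function spaces -/

/-- Lebesgue measure on the time interval `I = (0, T)`. -/
abbrev timeMeasure (T : ℝ) : Measure ℝ := volume.restrict (Ioo 0 T)

section Spaces

variable {V H : Type*} [NormedAddCommGroup V] [InnerProductSpace ℝ V]
  [NormedAddCommGroup H] [InnerProductSpace ℝ H]

variable (V) in
/-- The Bochner space `Y = L₂(I; V)`. -/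
abbrev SpaceY (T : ℝ) : Type _ := Lp V 2 (timeMeasure T)

variable (V) in
/-- The Bochner space `L₂(I; V')`. -/
abbrev SpaceYStar (T : ℝ) : Type _ := Lp (StrongDual ℝ V) 2 (timeMeasure T)

/-- The embedding `V ↪ V'` of the Gelfand triple `V ↪ H ≃ H' ↪ V'`, where `ι : V → H` is the
embedding of `V` into `H`:  `η ↦ (ζ ↦ ⟨ι η, ι ζ⟩)`. -/
def gelfand (ι : V →L[ℝ] H) : V →L[ℝ] StrongDual ℝ V :=
  (innerSL ℝ).bilinearComp ι ι

theorem gelfand_apply (ι : V →L[ℝ] H) (η ζ : V) : gelfand ι η ζ = inner ℝ (ι η) (ι ζ) := rfl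

/-- `w ∈ L₂(I; V')` is the weak (distributional) time derivative of `u ∈ L₂(I; V)`, where `u` is
viewed as a `V'`-valued function through the Gelfand triple:
`∫_I φ'(t) u(t) dt = - ∫_I φ(t) w(t) dt` in `V'` for all `φ ∈ C_c^∞(I)`. -/
def HasWeakTimeDeriv (ι : V →L[ℝ] H) {T : ℝ} (u : SpaceY V T) (w : SpaceYStar V T) : Prop :=
  ∀ φ : ℝ → ℝ, ContDiff ℝ ∞ φ → HasCompactSupport φ → tsupport φ ⊆ Ioo 0 T →
    ∫ t, deriv φ t • gelfand ι (u t) ∂timeMeasure T = - ∫ t, φ t • w t ∂timeMeasure T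

theorem integrable_test_smul {F : Type*} [NormedAddCommGroup F] [NormedSpace ℝ F] {T : ℝ}
    {φ : ℝ → ℝ} (hφ : Continuous φ) (hc : HasCompactSupport φ) (f : Lp F 2 (timeMeasure T)) :
    Integrable (fun t => φ t • f t) (timeMeasure T) := by
  obtain ⟨C, hC⟩ := hc.exists_bound_of_continuous hφ
  have hf : Integrable (fun t => f t) (timeMeasure T) := (Lp.memLp f).integrable one_le_two
  exact hf.bdd_smul C hφ.aestronglyMeasurable (Eventually.of_forall hC)

theorem integrable_test_smul_gelfand (ι : V →L[ℝ] H) {T : ℝ}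
    {φ : ℝ → ℝ} (hφ : Continuous φ) (hc : HasCompactSupport φ) (u : SpaceY V T) :
    Integrable (fun t => φ t • gelfand ι (u t)) (timeMeasure T) := by
  simpa using (gelfand ι).integrable_comp (integrable_test_smul hφ hc u)

/-- The weak time derivative is unique. -/
theorem HasWeakTimeDeriv.unique {ι : V →L[ℝ] H} {T : ℝ} {u : SpaceY V T} {w₁ w₂ : SpaceYStar V T}
    (h₁ : HasWeakTimeDeriv ι u w₁) (h₂ : HasWeakTimeDeriv ι u w₂) : w₁ = w₂ := by
  have hloc : Integrable (fun t => (w₁ - w₂ : SpaceYStar V T) t) (timeMeasure T) :=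
    (Lp.memLp (w₁ - w₂)).integrable one_le_two
  have key := isOpen_Ioo.ae_eq_zero_of_integral_contDiff_smul_eq_zero (U := Ioo 0 T)
    (μ := (volume : Measure ℝ)) (f := fun t => (w₁ - w₂ : SpaceYStar V T) t)
    (IntegrableOn.locallyIntegrableOn hloc) (by
      intro φ hφ hc hs
      have e : ∫ t, φ t • (w₁ - w₂ : SpaceYStar V T) t ∂timeMeasure T = 0 := by
        have : (fun t => φ t • (w₁ - w₂ : SpaceYStar V T) t) =ᵐ[timeMeasure T]
            fun t => φ t • w₁ t - φ t • w₂ t := by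
          filter_upwards [Lp.coeFn_sub w₁ w₂] with t ht
          rw [ht, Pi.sub_apply, smul_sub]
        rw [integral_congr_ae this, integral_sub (integrable_test_smul hφ.continuous hc w₁)
          (integrable_test_smul hφ.continuous hc w₂)]
        have a := (h₁ φ hφ hc hs).symm.trans (h₂ φ hφ hc hs)
        rw [neg_inj.mp a, sub_self]
      rw [← e]
      refine (setIntegral_eq_integral_of_forall_compl_eq_zero fun t ht => ?_).symm
      rw [image_eq_zero_of_notMem_tsupport fun h => ht (hs h), zero_smul])
  have h0 : (w₁ - w₂ : SpaceYStar V T) = 0 := by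
    rw [Lp.eq_zero_iff_ae_eq_zero]
    exact (ae_restrict_iff' measurableSet_Ioo).mpr key
  exact sub_eq_zero.mp h0

/-- The space `X = L₂(I; V) ∩ H¹(I; V')`.  Its elements are the `u ∈ L₂(I; V)` that have a weak
derivative `u' ∈ L₂(I; V')`, stored together with this (unique) derivative as the pair `(u, u')`,
so that the norm is `(‖u‖²_{L₂(I;V)} + ‖u'‖²_{L₂(I;V')})^{1/2}`. -/
def spaceX (ι : V →L[ℝ] H) (T : ℝ) : Submodule ℝ (WithLp 2 (SpaceY V T × SpaceYStar V T)) where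
  carrier := {p | HasWeakTimeDeriv ι p.fst p.snd}
  zero_mem' := by
    intro φ hφ hc hs
    have e1 : (fun t => deriv φ t • gelfand ι ((0 : SpaceY V T) t)) =ᵐ[timeMeasure T] 0 := by
      filter_upwards [Lp.coeFn_zero V 2 (timeMeasure T)] with t ht
      rw [ht, Pi.zero_apply, map_zero, smul_zero, Pi.zero_apply]
    have e2 : (fun t => φ t • (0 : SpaceYStar V T) t) =ᵐ[timeMeasure T] 0 := by
      filter_upwards [Lp.coeFn_zero (StrongDual ℝ V) 2 (timeMeasure T)] with t ht
      rw [ht, Pi.zero_apply, smul_zero]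
    simp only [WithLp.zero_fst, WithLp.zero_snd]
    rw [integral_congr_ae e1, integral_congr_ae e2]
    simp
  add_mem' := by
    intro p q hp hq φ hφ hc hs
    have hd : Continuous (deriv φ) := hφ.continuous_deriv (by simp)
    have e1 : (fun t => deriv φ t • gelfand ι ((p.fst + q.fst : SpaceY V T) t)) =ᵐ[timeMeasure T]
        fun t => deriv φ t • gelfand ι (p.fst t) + deriv φ t • gelfand ι (q.fst t) := by
      filter_upwards [Lp.coeFn_add p.fst q.fst] with t ht
      rw [ht, Pi.add_apply, map_add, smul_add]
    have e2 : (fun t => φ t • (p.snd + q.snd : SpaceYStar V T) t) =ᵐ[timeMeasure T]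
        fun t => φ t • p.snd t + φ t • q.snd t := by
      filter_upwards [Lp.coeFn_add p.snd q.snd] with t ht
      rw [ht, Pi.add_apply, smul_add]
    simp only [WithLp.add_fst, WithLp.add_snd]
    rw [integral_congr_ae e1, integral_congr_ae e2,
      integral_add (integrable_test_smul_gelfand ι hd hc.deriv _)
        (integrable_test_smul_gelfand ι hd hc.deriv _),
      integral_add (integrable_test_smul hφ.continuous hc _)
        (integrable_test_smul hφ.continuous hc _), hp φ hφ hc hs, hq φ hφ hc hs, neg_add]
  smul_mem' := by
    intro c p hp φ hφ hc hs
    have e1 : (fun t => deriv φ t • gelfand ι ((c • p.fst : SpaceY V T) t)) =ᵐ[timeMeasure T]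
        fun t => c • (deriv φ t • gelfand ι (p.fst t)) := by
      filter_upwards [Lp.coeFn_smul c p.fst] with t ht
      rw [ht, Pi.smul_apply, map_smul, smul_comm]
    have e2 : (fun t => φ t • (c • p.snd : SpaceYStar V T) t) =ᵐ[timeMeasure T]
        fun t => c • (φ t • p.snd t) := by
      filter_upwards [Lp.coeFn_smul c p.snd] with t ht
      rw [ht, Pi.smul_apply, smul_comm]
    simp only [WithLp.smul_fst, WithLp.smul_snd]
    rw [integral_congr_ae e1, integral_congr_ae e2, integral_smul, integral_smul,
      hp φ hφ hc hs, smul_neg]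

/-- The embedding `X ↪ Y`, `u ↦ u`. -/
def embXY (ι : V →L[ℝ] H) (T : ℝ) : spaceX ι T →L[ℝ] SpaceY V T :=
  WithLp.fstL 2 ℝ _ _ ∘L (spaceX ι T).subtypeL

/-- The weak time derivative `X → L₂(I; V')`, `u ↦ du/dt`. -/
def timeDeriv (ι : V →L[ℝ] H) (T : ℝ) : spaceX ι T →L[ℝ] SpaceYStar V T :=
  WithLp.sndL 2 ℝ _ _ ∘L (spaceX ι T).subtypeL

theorem hasWeakTimeDeriv_timeDeriv (ι : V →L[ℝ] H) (T : ℝ) (u : spaceX ι T) :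
    HasWeakTimeDeriv ι (embXY ι T u) (timeDeriv ι T u) := u.2

theorem embXY_injective (ι : V →L[ℝ] H) (T : ℝ) : Function.Injective (embXY ι T) := by
  intro u v huv
  have h2 : timeDeriv ι T u = timeDeriv ι T v :=
    HasWeakTimeDeriv.unique (hasWeakTimeDeriv_timeDeriv ι T u)
      (huv ▸ hasWeakTimeDeriv_timeDeriv ι T v)
  exact Subtype.ext (WithLp.ofLp_injective 2 (Prod.ext huv h2))

/-- `Γ` is the continuous embedding `X ↪ C([0,T]; H)`: it sends every `u ∈ X` to the continuous
representative of `u`, viewed as an `H`-valued function. -/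
def IsContEmbedding (ι : V →L[ℝ] H) (T : ℝ)
    (Γ : spaceX ι T →L[ℝ] C(Icc (0 : ℝ) T, H)) : Prop :=
  ∀ u : spaceX ι T, ∀ᵐ t ∂timeMeasure T, ∀ ht : t ∈ Icc 0 T, Γ u ⟨t, ht⟩ = ι (embXY ι T u t)

theorem IsContEmbedding.unique {ι : V →L[ℝ] H} {T : ℝ} (hT : 0 < T)
    {Γ₁ Γ₂ : spaceX ι T →L[ℝ] C(Icc (0 : ℝ) T, H)}
    (h₁ : IsContEmbedding ι T Γ₁) (h₂ : IsContEmbedding ι T Γ₂) : Γ₁ = Γ₂ := by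
  ext u t
  have key := Measure.eqOn_Icc_of_ae_eq (volume : Measure ℝ) hT.ne
    (f := IccExtend hT.le (Γ₁ u)) (g := IccExtend hT.le (Γ₂ u)) (by
      rw [← restrict_Ioo_eq_restrict_Icc]
      filter_upwards [h₁ u, h₂ u, ae_restrict_mem measurableSet_Ioo] with s e₁ e₂ hs
      have hs' := Ioo_subset_Icc_self hs
      rw [IccExtend_of_mem _ _ hs', IccExtend_of_mem _ _ hs', e₁ hs', e₂ hs'])
    (Γ₁ u).continuous.Icc_extend'.continuousOn (Γ₂ u).continuous.Icc_extend'.continuousOn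
  have := key t.2
  rwa [IccExtend_of_mem _ _ t.2, IccExtend_of_mem _ _ t.2] at this

open Classical in
/-- The (unique) continuous embedding `X ↪ C([0,T]; H)`, with value `0` if there were none. -/
def contEmb (ι : V →L[ℝ] H) (T : ℝ) : spaceX ι T →L[ℝ] C(Icc (0 : ℝ) T, H) :=
  if h : ∃ Γ, IsContEmbedding ι T Γ then h.choose else 0

/-- The trace map `γ_t : X → H`, `u ↦ u(t)`, for `t ∈ [0, T]`. -/
def trace (ι : V →L[ℝ] H) (T : ℝ) (t : Icc (0 : ℝ) T) : spaceX ι T →L[ℝ] H :=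
  ContinuousMap.evalCLM ℝ t ∘L contEmb ι T

end Spaces

/-! ### The family of bilinear forms `a(t; ·, ·)` -/

/-- A family of bilinear forms `a(t; ·, ·)` on `V × V`, measurable in `t ∈ I = (0, T)`, and
bounded and coercive uniformly in a.e. `t ∈ I`. -/
structure CoerciveFamily (V : Type*) [NormedAddCommGroup V] [InnerProductSpace ℝ V] (T : ℝ) where
  form : ℝ → LinearMap.BilinForm ℝ V
  aemeasurable : ∀ η ζ : V, AEMeasurable (fun t => form t η ζ) (timeMeasure T)
  bounded : ∃ M : ℝ, ∀ᵐ t ∂timeMeasure T, ∀ η ζ : V, |form t η ζ| ≤ M * ‖η‖ * ‖ζ‖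
  coercive : ∃ α : ℝ, 0 < α ∧ ∀ᵐ t ∂timeMeasure T, ∀ η : V, α * ‖η‖ ^ 2 ≤ form t η η

section Operators

variable {V H : Type*} [NormedAddCommGroup V] [InnerProductSpace ℝ V]
  [NormedAddCommGroup H] [InnerProductSpace ℝ H] {T : ℝ}

set_option linter.unusedSectionVars false

theorem CoerciveFamily.aemeasurable_simple (a : CoerciveFamily V T) (f g : SimpleFunc ℝ V) :
    AEMeasurable (fun t => a.form t (f t) (g t)) (timeMeasure T) := by
  have e : (fun t => a.form t (f t) (g t)) = fun t => ∑ x ∈ f.range, ∑ y ∈ g.range,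
      (f ⁻¹' {x} ∩ g ⁻¹' {y}).indicator (fun t => a.form t x y) t := by
    funext t
    rw [Finset.sum_eq_single (f t), Finset.sum_eq_single (g t)]
    · rw [indicator_of_mem]
      exact ⟨rfl, rfl⟩
    · intro y _ hy
      exact indicator_of_notMem (fun h => hy h.2.symm) _
    · intro h
      exact absurd (g.mem_range_self t) h
    · intro x _ hx
      refine Finset.sum_eq_zero fun y _ => indicator_of_notMem (fun h => hx h.1.symm) _
    · intro h
      exact absurd (f.mem_range_self t) h
  rw [e]
  refine Finset.aemeasurable_fun_sum _ fun x _ => Finset.aemeasurable_fun_sum _ fun y _ => ?_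
  exact (a.aemeasurable x y).indicator
    ((f.measurableSet_fiber x).inter (g.measurableSet_fiber y))

theorem CoerciveFamily.aemeasurable_comp (a : CoerciveFamily V T) {u v : ℝ → V}
    (hu : AEStronglyMeasurable u (timeMeasure T)) (hv : AEStronglyMeasurable v (timeMeasure T)) :
    AEMeasurable (fun t => a.form t (u t) (v t)) (timeMeasure T) := by
  obtain ⟨f, hf, huf⟩ := hu
  obtain ⟨g, hg, hvg⟩ := hv
  obtain ⟨M, hM⟩ := a.bounded
  refine aemeasurable_of_tendsto_metrizable_ae atTop
    (fun n => a.aemeasurable_simple (hf.approx n) (hg.approx n)) ?_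
  filter_upwards [huf, hvg, hM] with t h1 h2 hMt
  rw [h1, h2]
  have key : Continuous fun p : V × V => a.form t p.1 p.2 := by
    have := ((a.form t).mkContinuous₂ M (by simpa using hMt)).continuous₂
    exact this
  exact (key.tendsto (f t, g t)).comp
    ((hf.tendsto_approx t).prodMk_nhds (hg.tendsto_approx t))

theorem integrable_norm_mul_norm (u v : SpaceY V T) :
    Integrable (fun t => ‖u t‖ * ‖v t‖) (timeMeasure T) :=
  (Lp.memLp u).norm.integrable_mul (Lp.memLp v).norm

theorem integral_norm_mul_norm_le (u v : SpaceY V T) :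
    ∫ t, ‖u t‖ * ‖v t‖ ∂timeMeasure T ≤ ‖u‖ * ‖v‖ := by
  have hu := (Lp.memLp u).norm
  have hv := (Lp.memLp v).norm
  have e : inner ℝ (hu.toLp _) (hv.toLp _) = ∫ t, ‖u t‖ * ‖v t‖ ∂timeMeasure T := by
    rw [L2.inner_def]
    refine integral_congr_ae ?_
    filter_upwards [hu.coeFn_toLp, hv.coeFn_toLp] with t h1 h2
    rw [h1, h2]
    simp [mul_comm]
  rw [← e]
  refine (real_inner_le_norm _ _).trans (le_of_eq ?_)
  rw [Lp.norm_toLp, Lp.norm_toLp, eLpNorm_norm, eLpNorm_norm, ← Lp.norm_def, ← Lp.norm_def]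

theorem CoerciveFamily.integrable_comp (a : CoerciveFamily V T) (u v : SpaceY V T) :
    Integrable (fun t => a.form t (u t) (v t)) (timeMeasure T) := by
  obtain ⟨M, hM⟩ := a.bounded
  refine ((integrable_norm_mul_norm u v).const_mul M).mono'
    (a.aemeasurable_comp (Lp.aestronglyMeasurable u)
      (Lp.aestronglyMeasurable v)).aestronglyMeasurable ?_
  filter_upwards [hM] with t ht
  simpa [mul_assoc] using ht (u t) (v t)

/-- `A : Y → Y'`, `(Au)(v) = ∫_I a(t; u(t), v(t)) dt`. -/
def opA (a : CoerciveFamily V T) : SpaceY V T →L[ℝ] StrongDual ℝ (SpaceY V T) :=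
  LinearMap.mkContinuousOfExistsBound₂
    (LinearMap.mk₂ ℝ (fun u v => ∫ t, a.form t (u t) (v t) ∂timeMeasure T)
      (fun u₁ u₂ v => by
        rw [← integral_add (a.integrable_comp _ _) (a.integrable_comp _ _)]
        refine integral_congr_ae ?_
        filter_upwards [Lp.coeFn_add u₁ u₂] with t ht
        rw [ht, Pi.add_apply, LinearMap.BilinForm.add_left])
      (fun c u v => by
        rw [smul_eq_mul, ← integral_const_mul]
        refine integral_congr_ae ?_
        filter_upwards [Lp.coeFn_smul c u] with t ht
        simp [ht])
      (fun u v₁ v₂ => by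
        rw [← integral_add (a.integrable_comp _ _) (a.integrable_comp _ _)]
        refine integral_congr_ae ?_
        filter_upwards [Lp.coeFn_add v₁ v₂] with t ht
        rw [ht, Pi.add_apply, LinearMap.BilinForm.add_right])
      (fun c u v => by
        rw [smul_eq_mul, ← integral_const_mul]
        refine integral_congr_ae ?_
        filter_upwards [Lp.coeFn_smul c v] with t ht
        simp [ht]))
    (by
      obtain ⟨M, hM⟩ := a.bounded
      refine ⟨max M 0, fun u v => ?_⟩
      have h : ‖∫ t, a.form t (u t) (v t) ∂timeMeasure T‖
          ≤ ∫ t, max M 0 * (‖u t‖ * ‖v t‖) ∂timeMeasure T := by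
        refine norm_integral_le_of_norm_le ((integrable_norm_mul_norm u v).const_mul _) ?_
        filter_upwards [hM] with t ht
        refine (ht (u t) (v t)).trans ?_
        rw [mul_assoc]
        exact mul_le_mul_of_nonneg_right (le_max_left _ _) (by positivity)
      rw [integral_const_mul] at h
      rw [mul_assoc]
      exact h.trans (mul_le_mul_of_nonneg_left (integral_norm_mul_norm_le u v) (le_max_right _ _)))

theorem opA_apply (a : CoerciveFamily V T) (u v : SpaceY V T) :
    opA a u v = ∫ t, a.form t (u t) (v t) ∂timeMeasure T := rfl

/-! Below, the dual `G' : F → E'` of an operator `G : E → F'` is `G.flip`,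
that is, `(G' f)(e) = (G e)(f)`. -/

/-- `A_s = (A + A') / 2 : Y → Y'`. -/
def opAs (a : CoerciveFamily V T) : SpaceY V T →L[ℝ] StrongDual ℝ (SpaceY V T) :=
  (1 / 2 : ℝ) • (opA a + (opA a).flip)

/-- `∂_t : X → Y'`, `(∂_t w)(v) = ∫_I ⟨(dw/dt)(t), v(t)⟩ dt`. -/
def opDt (ι : V →L[ℝ] H) (T : ℝ) : spaceX ι T →L[ℝ] StrongDual ℝ (SpaceY V T) :=
  ContinuousLinearMap.lpPairing (timeMeasure T) 2 2 (ContinuousLinearMap.id ℝ (StrongDual ℝ V)) ∘L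
    timeDeriv ι T

theorem opDt_apply (ι : V →L[ℝ] H) (w : spaceX ι T) (v : SpaceY V T) :
    opDt ι T w v = ∫ t, timeDeriv ι T w t (v t) ∂timeMeasure T :=
  ContinuousLinearMap.lpPairing_eq_integral _ _ _

/-- `B = ∂_t + A : X → Y'`. -/
def opB (ι : V →L[ℝ] H) (a : CoerciveFamily V T) :
    spaceX ι T →L[ℝ] StrongDual ℝ (SpaceY V T) :=
  opDt ι T + opA a ∘L embXY ι T

/-- `(Bw)(v) = ∫_I ⟨(dw/dt)(t), v(t)⟩ + a(t; w(t), v(t)) dt`. -/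
theorem opB_apply (ι : V →L[ℝ] H) (a : CoerciveFamily V T) (w : spaceX ι T) (v : SpaceY V T) :
    opB ι a w v = ∫ t, (timeDeriv ι T w t (v t) + a.form t (embXY ι T w t) (v t))
      ∂timeMeasure T := by
  have h : Integrable (fun t => timeDeriv ι T w t (v t)) (timeMeasure T) := by
    refine (L1.integrable_coeFn ((ContinuousLinearMap.id ℝ (StrongDual ℝ V)).holder 1
      (timeDeriv ι T w) v)).congr ?_
    exact (ContinuousLinearMap.id ℝ (StrongDual ℝ V)).coeFn_holder _ _
  rw [integral_add h (a.integrable_comp _ _), ← opDt_apply]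
  rfl

/-- `C = B - A_s : X → Y'`. -/
def opC (ι : V →L[ℝ] H) (a : CoerciveFamily V T) :
    spaceX ι T →L[ℝ] StrongDual ℝ (SpaceY V T) :=
  opB ι a - opAs a ∘L embXY ι T

/-- `γ_t' : H ≃ H' → X'`, `(γ_t' h)(v) = ⟨h, γ_t v⟩`. -/
def traceDual (ι : V →L[ℝ] H) (T : ℝ) (t : Icc (0 : ℝ) T) :
    H →L[ℝ] StrongDual ℝ (spaceX ι T) :=
  (innerSL ℝ ∘L trace ι T t).flip

theorem traceDual_apply (ι : V →L[ℝ] H) (t : Icc (0 : ℝ) T) (h : H) (v : spaceX ι T) :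
    traceDual ι T t h v = inner ℝ h (trace ι T t v) :=
  real_inner_comm _ _

/-- `f ↦ f|_X`, the dual `Y' → X'` of the embedding `X ↪ Y`. -/
def restrictX (ι : V →L[ℝ] H) (T : ℝ) :
    StrongDual ℝ (SpaceY V T) →L[ℝ] StrongDual ℝ (spaceX ι T) :=
  (embXY ι T).precomp ℝ

theorem restrictX_apply (ι : V →L[ℝ] H) (f : StrongDual ℝ (SpaceY V T)) (v : spaceX ι T) :
    restrictX ι T f v = f (embXY ι T v) := rfl

/-- `A_s + γ_T' γ_T : X → X'`. -/
def opAsTrace (ι : V →L[ℝ] H) (a : CoerciveFamily V T) (tT : Icc (0 : ℝ) T) :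
    spaceX ι T →L[ℝ] StrongDual ℝ (spaceX ι T) :=
  restrictX ι T ∘L opAs a ∘L embXY ι T + traceDual ι T tT ∘L trace ι T tT

/-- `C' A_s⁻¹ C + A_s + γ_T' γ_T : X → X'`. -/
def opBEN (ι : V →L[ℝ] H) (a : CoerciveFamily V T) (tT : Icc (0 : ℝ) T) :
    spaceX ι T →L[ℝ] StrongDual ℝ (spaceX ι T) :=
  (opC ι a).flip ∘L (opAs a).inverse ∘L opC ι a + opAsTrace ι a tT

/-- `B' A_s⁻¹ B + γ_0' γ_0 : X → X'`. -/
def opSchur (ι : V →L[ℝ] H) (a : CoerciveFamily V T) (t0 : Icc (0 : ℝ) T) :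
    spaceX ι T →L[ℝ] StrongDual ℝ (spaceX ι T) :=
  (opB ι a).flip ∘L (opAs a).inverse ∘L opB ι a + traceDual ι T t0 ∘L trace ι T t0

/-- The block operator `[[A_s, C], [C', -(A_s + γ_T' γ_T)]] : Y × X → Y' × X'`. -/
def opBlock (ι : V →L[ℝ] H) (a : CoerciveFamily V T) (tT : Icc (0 : ℝ) T) :
    SpaceY V T × spaceX ι T →L[ℝ] StrongDual ℝ (SpaceY V T) × StrongDual ℝ (spaceX ι T) :=
  ((opAs a).coprod (opC ι a)).prod ((opC ι a).flip.coprod (-opAsTrace ι a tT))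

end Operators

end Parabolic

end

/-!
The equation `B u = g`, `γ₀ u = u₀` is treated as a least-squares problem. Writing `B = C + A_s`
and expanding the normal operator `B' A_s⁻¹ B + γ₀' γ₀`, the cross terms `C + C'` collapse to
`∂_t + ∂_t'`, which by integration by parts equals `γ_T' γ_T - γ₀' γ₀` (`opBEN_eq_opSchur`). This
gives the form `C' A_s⁻¹ C + A_s + γ_T' γ_T`, whose quadratic form bounds `‖A_s⁻¹ C u‖_Y` and
`‖u‖_Y`, and therefore also `u'` (`isCoercive_opBEN`). The Lax–Milgram theorem makes it invertible,
and elimination of the first unknown transfers invertibility to the block operator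
(`opBlock_eq_iff`).

A solution of the normal equations solves `B u = g`, `γ₀ u = u₀` because the range of `(B, γ₀)` is
dense in `Y' × H` (`eq_zero_of_forall_opB_add_inner_eq_zero`): an annihilating pair `(λ, h)`
satisfies `λ' = a(t; ·, λ)` weakly, so that `λ ∈ X`; integration by parts then gives `λ(T) = 0`
and `λ(0) = h`, and the energy identity `(Aλ)(λ) = -‖λ(0)‖² / 2` forces `λ = 0`. Existence for the
evolution equation thus follows from the coercivity of the normal operator.

The analytic input, the embedding `X ↪ C([0, T]; H)` and integration by parts in `X`, is obtained
by density of `C¹` functions (`denseRange_ofC1`), for which both are elementary. For the density let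
`G = ι* ι : V → V` represent the scalar product of `H`. For `u ∈ X` the regularization
`u_ε = (G + ε)⁻¹ G u` converges to `u` in `X`, since `(G + ε)⁻¹ G → 1` strongly, and the weak
derivative of `u_ε` is the `V`-valued function `(G + ε)⁻¹ R⁻¹ u'` with `R : V → V'` the Riesz
isomorphism. By the du Bois-Reymond lemma, `u_ε` is a constant plus the primitive of its derivative,
and it is approximated in `X` by approximating the derivative by continuous functions.
-/

open MeasureTheory Set Filter Topology
open scoped ContDiff

noncomputable section

namespace Parabolic

/-! ### Continuously differentiable functions as elements of `X` -/

section Time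

variable {E F : Type*} [NormedAddCommGroup E] [NormedAddCommGroup F] {T : ℝ}

theorem integral_timeMeasure [NormedSpace ℝ E] (hT : 0 ≤ T) (f : ℝ → E) :
    ∫ t, f t ∂timeMeasure T = ∫ t in (0 : ℝ)..T, f t := by
  rw [intervalIntegral.integral_of_le hT, integral_Ioc_eq_integral_Ioo]

theorem memLp_timeMeasure_of_continuous {f : ℝ → E} (hf : Continuous f) :
    MemLp f 2 (timeMeasure T) := by
  obtain ⟨C, hC⟩ := (isCompact_Icc (a := (0 : ℝ)) (b := T)).exists_bound_of_continuousOn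
    hf.continuousOn
  refine MemLp.of_bound hf.aestronglyMeasurable C ?_
  filter_upwards [ae_restrict_mem measurableSet_Ioo] with t ht
  exact hC t (Ioo_subset_Icc_self ht)

theorem eq_zero_of_tsupport_subset_Ioo {φ : ℝ → ℝ} (hs : tsupport φ ⊆ Ioo 0 T) :
    φ 0 = 0 ∧ φ T = 0 :=
  ⟨image_eq_zero_of_notMem_tsupport fun h => lt_irrefl _ (hs h).1,
    image_eq_zero_of_notMem_tsupport fun h => lt_irrefl _ (hs h).2⟩

/-- Integration by parts on `(0, T)` against a test function. -/
theorem integral_deriv_smul_eq_neg [NormedSpace ℝ E] [CompleteSpace E] {φ : ℝ → ℝ}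
    (hφ : ContDiff ℝ 1 φ) (hs : tsupport φ ⊆ Ioo 0 T) {f : ℝ → E} (hf : ContDiff ℝ 1 f) :
    ∫ t, deriv φ t • f t ∂timeMeasure T = - ∫ t, φ t • deriv f t ∂timeMeasure T := by
  rcases lt_or_ge T 0 with hT | hT
  · simp [timeMeasure, Ioo_eq_empty_of_le hT.le]
  obtain ⟨h0, h1⟩ := eq_zero_of_tsupport_subset_Ioo hs
  have hd : ∀ t ∈ uIcc 0 T, HasDerivAt (fun t => φ t • f t) (φ t • deriv f t + deriv φ t • f t) t :=
    fun t _ => ((hφ.differentiable one_ne_zero) t).hasDerivAt.fun_smul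
      ((hf.differentiable one_ne_zero) t).hasDerivAt
  have c1 : Continuous fun t => φ t • deriv f t :=
    hφ.continuous.smul (hf.continuous_deriv le_rfl)
  have c2 : Continuous fun t => deriv φ t • f t :=
    (hφ.continuous_deriv le_rfl).smul hf.continuous
  have key := intervalIntegral.integral_eq_sub_of_hasDerivAt hd
    ((c1.add c2).intervalIntegrable 0 T)
  rw [intervalIntegral.integral_add (c1.intervalIntegrable 0 T) (c2.intervalIntegrable 0 T),
    h0, h1, zero_smul, zero_smul, sub_zero] at key
  rw [integral_timeMeasure hT, integral_timeMeasure hT]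
  exact eq_neg_of_add_eq_zero_right key

theorem integrable_norm_mul_norm_Lp (u : Lp E 2 (timeMeasure T)) (v : Lp F 2 (timeMeasure T)) :
    Integrable (fun t => ‖u t‖ * ‖v t‖) (timeMeasure T) :=
  (Lp.memLp u).norm.integrable_mul (Lp.memLp v).norm

theorem integral_norm_mul_norm_Lp_le (u : Lp E 2 (timeMeasure T)) (v : Lp F 2 (timeMeasure T)) :
    ∫ t, ‖u t‖ * ‖v t‖ ∂timeMeasure T ≤ ‖u‖ * ‖v‖ := by
  have hu := (Lp.memLp u).norm
  have hv := (Lp.memLp v).norm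
  have e : inner ℝ (hu.toLp _) (hv.toLp _) = ∫ t, ‖u t‖ * ‖v t‖ ∂timeMeasure T := by
    rw [L2.inner_def]
    refine integral_congr_ae ?_
    filter_upwards [hu.coeFn_toLp, hv.coeFn_toLp] with t h1 h2
    rw [h1, h2]
    simp [mul_comm]
  rw [← e]
  refine (real_inner_le_norm _ _).trans (le_of_eq ?_)
  rw [Lp.norm_toLp, Lp.norm_toLp, eLpNorm_norm, eLpNorm_norm, ← Lp.norm_def, ← Lp.norm_def]

end Time

section Smooth

variable {V H : Type*} [NormedAddCommGroup V] [InnerProductSpace ℝ V]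
  [NormedAddCommGroup H] [InnerProductSpace ℝ H]

variable (V) in
/-- The continuously differentiable functions `ℝ → V`. Their restrictions to `(0, T)` serve as the
smooth elements of `X`. -/
def c1Submodule : Submodule ℝ (ℝ → V) where
  carrier := {f | ContDiff ℝ 1 f}
  zero_mem' := by
    rw [mem_ofPred_eq]
    exact contDiff_const
  add_mem' := fun {_ _} hf hg => by
    rw [mem_ofPred_eq] at *
    exact hf.add hg
  smul_mem' c f hf := by
    rw [mem_ofPred_eq] at *
    exact hf.const_smul c

variable (V) in
/-- The type of continuously differentiable functions `ℝ → V`. -/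
abbrev C1Fun : Type _ := c1Submodule V

theorem C1Fun.contDiff (f : C1Fun V) : ContDiff ℝ 1 f.1 := f.2

theorem C1Fun.continuous (f : C1Fun V) : Continuous f.1 := f.contDiff.continuous

theorem C1Fun.continuous_deriv (f : C1Fun V) : Continuous (deriv f.1) :=
  f.contDiff.continuous_deriv le_rfl

theorem C1Fun.hasDerivAt (f : C1Fun V) (t : ℝ) : HasDerivAt f.1 (deriv f.1 t) t :=
  (f.contDiff.differentiable one_ne_zero t).hasDerivAt

theorem C1Fun.memLp (f : C1Fun V) (T : ℝ) : MemLp f.1 2 (timeMeasure T) :=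
  memLp_timeMeasure_of_continuous f.continuous

theorem C1Fun.memLp_gelfand_deriv (ι : V →L[ℝ] H) (f : C1Fun V) (T : ℝ) :
    MemLp (fun t => gelfand ι (deriv f.1 t)) 2 (timeMeasure T) :=
  memLp_timeMeasure_of_continuous ((gelfand ι).continuous.comp f.continuous_deriv)

theorem C1Fun.hasWeakTimeDeriv (ι : V →L[ℝ] H) (T : ℝ) (f : C1Fun V) :
    HasWeakTimeDeriv ι ((f.memLp T).toLp _) ((f.memLp_gelfand_deriv ι T).toLp _) := by
  intro φ hφ hc hs
  have e1 : (fun t => deriv φ t • gelfand ι ((f.memLp T).toLp _ t)) =ᵐ[timeMeasure T]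
      fun t => deriv φ t • gelfand ι (f.1 t) := by
    filter_upwards [(f.memLp T).coeFn_toLp] with t ht
    rw [ht]
  have e2 : (fun t => φ t • (f.memLp_gelfand_deriv ι T).toLp _ t) =ᵐ[timeMeasure T]
      fun t => φ t • deriv (fun s => gelfand ι (f.1 s)) t := by
    filter_upwards [(f.memLp_gelfand_deriv ι T).coeFn_toLp] with t ht
    have hd : HasDerivAt (fun s => gelfand ι (f.1 s)) (gelfand ι (deriv f.1 t)) t :=
      (gelfand ι).hasFDerivAt.comp_hasDerivAt t (f.hasDerivAt t)
    rw [ht, hd.deriv]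
  rw [integral_congr_ae e1, integral_congr_ae e2]
  exact integral_deriv_smul_eq_neg (hφ.of_le (by exact_mod_cast le_top)) hs
    ((gelfand ι).contDiff.comp f.contDiff)

/-- The map sending a `C¹` function to its class in `X`, together with its classical derivative. -/
def ofC1 (ι : V →L[ℝ] H) (T : ℝ) : C1Fun V →ₗ[ℝ] spaceX ι T where
  toFun f := ⟨WithLp.toLp 2 ((f.memLp T).toLp _, (f.memLp_gelfand_deriv ι T).toLp _),
    f.hasWeakTimeDeriv ι T⟩
  map_add' f g := by
    refine embXY_injective ι T ?_
    exact MemLp.toLp_add (f.memLp T) (g.memLp T)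
  map_smul' c f := by
    refine embXY_injective ι T ?_
    exact MemLp.toLp_const_smul c (f.memLp T)

theorem embXY_ofC1 (ι : V →L[ℝ] H) (T : ℝ) (f : C1Fun V) :
    embXY ι T (ofC1 ι T f) =ᵐ[timeMeasure T] f.1 :=
  (f.memLp T).coeFn_toLp

theorem timeDeriv_ofC1 (ι : V →L[ℝ] H) (T : ℝ) (f : C1Fun V) :
    timeDeriv ι T (ofC1 ι T f) =ᵐ[timeMeasure T] fun t => gelfand ι (deriv f.1 t) :=
  (f.memLp_gelfand_deriv ι T).coeFn_toLp

/-- The product `t ↦ φ(t) v` of a scalar `C¹` function and a vector of `V`. -/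
def C1Fun.smulVec {φ : ℝ → ℝ} (hφ : ContDiff ℝ 1 φ) (v : V) : C1Fun V :=
  ⟨fun t => φ t • v, hφ.smul contDiff_const⟩

theorem C1Fun.deriv_smulVec {φ : ℝ → ℝ} (hφ : ContDiff ℝ 1 φ) (v : V) (t : ℝ) :
    deriv (C1Fun.smulVec hφ v).1 t = deriv φ t • v :=
  (((hφ.differentiable one_ne_zero) t).hasDerivAt.smul_const v).deriv

theorem norm_sq_spaceX (ι : V →L[ℝ] H) (T : ℝ) (u : spaceX ι T) :
    ‖u‖ ^ 2 = ‖embXY ι T u‖ ^ 2 + ‖timeDeriv ι T u‖ ^ 2 :=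
  WithLp.prod_norm_sq_eq_of_L2 (u : WithLp 2 (SpaceY V T × SpaceYStar V T))

theorem norm_embXY_le (ι : V →L[ℝ] H) (T : ℝ) (u : spaceX ι T) : ‖embXY ι T u‖ ≤ ‖u‖ :=
  le_of_sq_le_sq (by rw [norm_sq_spaceX]; nlinarith [sq_nonneg ‖timeDeriv ι T u‖]) (norm_nonneg _)

theorem norm_timeDeriv_le (ι : V →L[ℝ] H) (T : ℝ) (u : spaceX ι T) : ‖timeDeriv ι T u‖ ≤ ‖u‖ :=
  le_of_sq_le_sq (by rw [norm_sq_spaceX]; nlinarith [sq_nonneg ‖embXY ι T u‖]) (norm_nonneg _)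

/-- Convergence in `X` is convergence in `Y` together with convergence of the derivatives. -/
theorem tendsto_spaceX {α : Type*} {l : Filter α} {ι : V →L[ℝ] H} {T : ℝ} {x : α → spaceX ι T}
    {u : spaceX ι T} (h₁ : Tendsto (fun n => embXY ι T (x n)) l (𝓝 (embXY ι T u)))
    (h₂ : Tendsto (fun n => timeDeriv ι T (x n)) l (𝓝 (timeDeriv ι T u))) :
    Tendsto x l (𝓝 u) := by
  rw [tendsto_iff_norm_sub_tendsto_zero] at *
  have h := ((h₁.pow 2).add (h₂.pow 2)).sqrt
  simp only [← map_sub, ← norm_sq_spaceX, Real.sqrt_sq (norm_nonneg _)] at h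
  simpa using h

end Smooth

/-! ### The Lax–Milgram theorem and resolvents of positive operators -/

section LaxMilgram

variable {E F : Type*} [NormedAddCommGroup F] [InnerProductSpace ℝ F] [CompleteSpace F]

theorem isInvertible_of_isCoercive {B : F →L[ℝ] StrongDual ℝ F} (hB : IsCoercive B) :
    B.IsInvertible := by
  refine ⟨hB.continuousLinearEquivOfBilin.trans
    (InnerProductSpace.toDual ℝ F).toContinuousLinearEquiv, ?_⟩
  ext v w
  exact hB.continuousLinearEquivOfBilin_apply v w

/-- The Lax–Milgram theorem on a Banach space whose norm is that of a Hilbert space, without a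
chosen inner product. -/
theorem isInvertible_of_isCoercive_of_linearIsometry [NormedAddCommGroup E] [NormedSpace ℝ E]
    [CompleteSpace E] (L : E →ₗᵢ[ℝ] F) {B : E →L[ℝ] StrongDual ℝ E} (hB : IsCoercive B) :
    B.IsInvertible := by
  have hc : IsClosed (LinearMap.range L.toLinearMap : Set F) := by
    rw [LinearMap.coe_range]
    exact L.isometry.isClosedEmbedding.isClosed_range
  have : CompleteSpace (LinearMap.range L.toLinearMap) := hc.completeSpace_coe
  let e : E ≃ₗᵢ[ℝ] LinearMap.range L.toLinearMap := L.equivRange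
  let e' := e.toContinuousLinearEquiv
  let B' : LinearMap.range L.toLinearMap →L[ℝ] StrongDual ℝ (LinearMap.range L.toLinearMap) :=
    B.bilinearComp (e'.symm : _ →L[ℝ] E) (e'.symm : _ →L[ℝ] E)
  have hB' : IsCoercive B' := by
    obtain ⟨C, hC, h⟩ := hB
    refine ⟨C, hC, fun u => ?_⟩
    have := h (e.symm u)
    rwa [e.symm.norm_map] at this
  obtain ⟨b, hb⟩ := isInvertible_of_isCoercive hB'
  refine ⟨(e'.trans b).trans (e'.arrowCongr (ContinuousLinearEquiv.refl ℝ ℝ)).symm, ?_⟩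
  ext v w
  have h1 : b (e' v) = B' (e' v) := by rw [← hb]; rfl
  change b (e' v) (e' w) = B v w
  rw [h1]
  change B (e'.symm (e' v)) (e'.symm (e' w)) = B v w
  simp

end LaxMilgram

section Resolvent

variable {E : Type*} [NormedAddCommGroup E] [InnerProductSpace ℝ E]

/-- If `G` is symmetric, nonnegative and injective, then `(G + ε)⁻¹ G` converges strongly to the
identity as `ε → 0`: the operators `ε (G + ε)⁻¹ = 1 - (G + ε)⁻¹ G` are contractions, and they are
`O(ε)` on the dense range of `G`. -/
theorem tendsto_resolvent_comp [CompleteSpace E] {G : E →L[ℝ] E}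
    (hsymm : ∀ x y, inner ℝ (G x) y = inner ℝ x (G y)) (hpos : ∀ x, 0 ≤ inner ℝ (G x) x)
    (hinj : Function.Injective G) {ε : ℕ → ℝ} (hε : ∀ n, 0 < ε n) (hε0 : Tendsto ε atTop (𝓝 0))
    {K : ℕ → E →L[ℝ] E} (hK : ∀ n x, K n (G x + ε n • x) = x)
    (hK' : ∀ n x, G (K n x) + ε n • K n x = x) (x : E) :
    Tendsto (fun n => K n (G x)) atTop (𝓝 x) := by
  have hbound : ∀ n y, ε n * ‖K n y‖ ≤ ‖y‖ := by
    intro n y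
    rcases eq_or_ne (K n y) 0 with h0 | h0
    · simp [h0]
    have h1 : ε n * ‖K n y‖ * ‖K n y‖ ≤ ‖y‖ * ‖K n y‖ := by
      calc ε n * ‖K n y‖ * ‖K n y‖ = inner ℝ (ε n • K n y) (K n y) := by
            rw [real_inner_smul_left, real_inner_self_eq_norm_mul_norm, mul_assoc]
        _ ≤ inner ℝ (G (K n y) + ε n • K n y) (K n y) := by
            rw [inner_add_left]
            linarith [hpos (K n y)]
        _ = inner ℝ y (K n y) := by rw [hK']
        _ ≤ _ := real_inner_le_norm _ _
    exact le_of_mul_le_mul_right h1 (norm_pos_iff.mpr h0)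
  have heq : ∀ n y, K n (G y) - y = -(ε n • K n y) := by
    intro n y
    have := hK n y
    rw [map_add, map_smul] at this
    rw [sub_eq_iff_eq_add, neg_add_eq_sub, eq_sub_iff_add_eq, this]
  have hrange : ∀ n z, ‖ε n • K n (G z)‖ ≤ ε n * (2 * ‖z‖) := by
    intro n z
    rw [norm_smul, Real.norm_of_nonneg (hε n).le]
    refine mul_le_mul_of_nonneg_left ?_ (hε n).le
    have h2 : ‖K n (G z) - z‖ ≤ ‖z‖ := by
      rw [heq, norm_neg, norm_smul, Real.norm_of_nonneg (hε n).le]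
      exact hbound n z
    calc ‖K n (G z)‖ = ‖(K n (G z) - z) + z‖ := by rw [sub_add_cancel]
      _ ≤ ‖K n (G z) - z‖ + ‖z‖ := norm_add_le _ _
      _ ≤ 2 * ‖z‖ := by linarith
  have hdense : DenseRange G := by
    have h : (LinearMap.range G.toLinearMap)ᗮ = ⊥ := by
      rw [Submodule.eq_bot_iff]
      intro y hy
      refine hinj ?_
      rw [map_zero, ← inner_self_eq_zero (𝕜 := ℝ), ← hsymm]
      exact (Submodule.mem_orthogonal _ _).mp hy _ ⟨G y, rfl⟩
    exact Submodule.dense_iff_topologicalClosure_eq_top.mpr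
      (Submodule.topologicalClosure_eq_top_iff.mpr h)
  rw [tendsto_iff_norm_sub_tendsto_zero, Metric.tendsto_atTop]
  intro δ hδ
  obtain ⟨z, hz⟩ := hdense.exists_dist_lt x (half_pos hδ)
  have hlim : Tendsto (fun n => ε n * (2 * ‖z‖)) atTop (𝓝 0) := by
    simpa using hε0.mul_const (2 * ‖z‖)
  obtain ⟨N, hN⟩ := (Metric.tendsto_atTop.mp hlim) (δ / 2) (half_pos hδ)
  refine ⟨N, fun n hn => ?_⟩
  have h1 : ‖K n (G x) - x‖ ≤ ‖x - G z‖ + ε n * (2 * ‖z‖) := by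
    rw [heq, norm_neg]
    calc ‖ε n • K n x‖ = ‖ε n • K n (x - G z) + ε n • K n (G z)‖ := by
          rw [← smul_add, ← map_add, sub_add_cancel]
      _ ≤ ‖ε n • K n (x - G z)‖ + ‖ε n • K n (G z)‖ := norm_add_le _ _
      _ ≤ _ := by
          refine add_le_add ?_ (hrange n z)
          rw [norm_smul, Real.norm_of_nonneg (hε n).le]
          exact hbound n _
  have h2 := hN n hn
  rw [Real.dist_eq, sub_zero] at h2 ⊢
  rw [dist_eq_norm] at hz
  rw [abs_of_nonneg (norm_nonneg _)]
  linarith [le_abs_self (ε n * (2 * ‖z‖))]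

theorem exists_resolvent [CompleteSpace E] {G : E →L[ℝ] E} (hpos : ∀ x, 0 ≤ inner ℝ (G x) x)
    {ε : ℝ} (hε : 0 < ε) :
    ∃ K : E →L[ℝ] E, (∀ x, K (G x + ε • x) = x) ∧ ∀ x, G (K x) + ε • K x = x := by
  let B : E →L[ℝ] StrongDual ℝ E := innerSL ℝ ∘L (G + ε • ContinuousLinearMap.id ℝ E)
  have hB : IsCoercive B := by
    refine ⟨ε, hε, fun u => ?_⟩
    change ε * ‖u‖ * ‖u‖ ≤ inner ℝ (G u + ε • u) u
    rw [inner_add_left, real_inner_smul_left, real_inner_self_eq_norm_mul_norm]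
    nlinarith [hpos u]
  let e := hB.continuousLinearEquivOfBilin
  have he : ∀ x, e x = G x + ε • x := fun x =>
    ext_inner_right ℝ fun y => hB.continuousLinearEquivOfBilin_apply x y
  refine ⟨e.symm, fun x => ?_, fun x => ?_⟩
  · rw [← he]
    exact e.symm_apply_apply x
  · rw [← he]
    exact e.apply_symm_apply x

end Resolvent

/-! ### The fundamental lemma of the calculus of variations for derivatives -/

section DuBoisReymond

variable {E : Type*} [NormedAddCommGroup E] [NormedSpace ℝ E] {T : ℝ}

theorem integral_timeMeasure_of_tsupport_subset {f : ℝ → E} (hs : tsupport f ⊆ Ioo 0 T) :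
    ∫ t, f t ∂timeMeasure T = ∫ t, f t :=
  setIntegral_eq_integral_of_forall_compl_eq_zero fun _ ht =>
    image_eq_zero_of_notMem_tsupport fun h => ht (hs h)

/-- A test function of mean zero is the derivative of a test function. -/
theorem exists_primitive_test {χ : ℝ → ℝ} (hχ : ContDiff ℝ ∞ χ) (hc : HasCompactSupport χ)
    (hs : tsupport χ ⊆ Ioo 0 T) (h0 : ∫ t, χ t = 0) :
    ∃ φ : ℝ → ℝ, ContDiff ℝ ∞ φ ∧ HasCompactSupport φ ∧ tsupport φ ⊆ Ioo 0 T ∧ deriv φ = χ := by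
  rcases (tsupport χ).eq_empty_or_nonempty with he | hne
  · have : χ = 0 := tsupport_eq_empty_iff.mp he
    exact ⟨0, contDiff_const, HasCompactSupport.zero, by simp, by simp [this]⟩
  obtain ⟨a, ha⟩ := hc.isCompact.exists_isLeast hne
  obtain ⟨b, hb⟩ := hc.isCompact.exists_isGreatest hne
  have hout : ∀ t, t ∉ Icc a b → χ t = 0 := fun t ht =>
    image_eq_zero_of_notMem_tsupport fun h => ht ⟨ha.2 h, hb.2 h⟩
  have hder : ∀ t, HasDerivAt (fun t => ∫ s in (a - 1)..t, χ s) (χ t) t := fun t =>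
    intervalIntegral.integral_hasDerivAt_right (hχ.continuous.intervalIntegrable _ _)
      (hχ.continuous.stronglyMeasurableAtFilter _ _) hχ.continuous.continuousAt
  have hderiv : deriv (fun t => ∫ s in (a - 1)..t, χ s) = χ := funext fun t => (hder t).deriv
  have hzero : ∀ t, t ∉ Icc a b → ∫ s in (a - 1)..t, χ s = 0 := by
    intro t ht
    rcases lt_or_ge t a with h | h
    · refine (intervalIntegral.integral_congr fun s hs => ?_).trans intervalIntegral.integral_zero
      refine hout s fun h' => ?_
      have h2 := hs.2
      have : s < a := lt_of_le_of_lt h2 (max_lt (by linarith) h)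
      exact absurd h'.1 (not_le.mpr this)
    · have hbt : b < t := by
        by_contra h'
        exact ht ⟨h, not_lt.mp h'⟩
      have hab : a ≤ b := ha.2 hb.1
      rw [intervalIntegral.integral_of_le (by linarith), ← h0]
      refine setIntegral_eq_integral_of_forall_compl_eq_zero fun s hs => hout s fun h' => hs ?_
      exact ⟨by linarith [h'.1], by linarith [h'.2]⟩
  have hts : tsupport (fun t => ∫ s in (a - 1)..t, χ s) ⊆ Icc a b :=
    closure_minimal (fun t ht => by_contra fun h => ht (hzero t h)) isClosed_Icc
  refine ⟨fun t => ∫ s in (a - 1)..t, χ s, ?_, ?_, ?_, hderiv⟩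
  · rw [contDiff_infty_iff_deriv, hderiv]
    exact ⟨fun t => (hder t).differentiableAt, hχ⟩
  · exact isCompact_Icc.of_isClosed_subset (isClosed_tsupport _) hts
  · exact hts.trans (Icc_subset_Ioo (hs ha.1).1 (hs hb.1).2)

/-- The du Bois-Reymond lemma: a function on `(0, T)` with vanishing weak derivative is constant. -/
theorem ae_eq_const_of_integral_deriv_smul_eq_zero [CompleteSpace E] (hT : 0 < T) {h : ℝ → E}
    (hh : Integrable h (timeMeasure T))
    (H : ∀ φ : ℝ → ℝ, ContDiff ℝ ∞ φ → HasCompactSupport φ → tsupport φ ⊆ Ioo 0 T →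
      ∫ t, deriv φ t • h t ∂timeMeasure T = 0) :
    ∃ c, h =ᵐ[timeMeasure T] fun _ => c := by
  let β : ContDiffBump (T / 2) := ⟨T / 8, T / 4, by positivity, by linarith⟩
  let ψ₀ : ℝ → ℝ := β.normed volume
  have hψ₀ : ContDiff ℝ ∞ ψ₀ := β.contDiff_normed
  have hψ₀c : HasCompactSupport ψ₀ := β.hasCompactSupport_normed
  have hψ₀s : tsupport ψ₀ ⊆ Ioo 0 T := by
    rw [β.tsupport_normed_eq, Real.closedBall_eq_Icc]
    refine Icc_subset_Ioo ?_ ?_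
    · change 0 < T / 2 - T / 4
      linarith
    · change T / 2 + T / 4 < T
      linarith
  have hψ₀1 : ∫ t, ψ₀ t = 1 := β.integral_normed
  have hint : ∀ ψ : ℝ → ℝ, Continuous ψ → HasCompactSupport ψ →
      Integrable (fun t => ψ t • h t) (timeMeasure T) := fun ψ hψ hc => by
    obtain ⟨C, hC⟩ := hc.exists_bound_of_continuous hψ
    exact hh.bdd_smul C hψ.aestronglyMeasurable (Eventually.of_forall hC)
  set c : E := ∫ t, ψ₀ t • h t ∂timeMeasure T with hc_def
  refine ⟨c, ?_⟩
  have key := isOpen_Ioo.ae_eq_zero_of_integral_contDiff_smul_eq_zero (U := Ioo 0 T)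
    (μ := timeMeasure T) (f := fun t => h t - c)
    ((hh.sub (integrable_const c)).locallyIntegrable.locallyIntegrableOn _) (by
      intro ψ hψ hc hs
      have hψi : Integrable ψ (timeMeasure T) :=
        (hψ.continuous.integrable_of_hasCompactSupport hc).restrict
      -- Subtracting a multiple of `ψ₀` gives mean zero, hence the derivative of a test function.
      set m : ℝ := ∫ t, ψ t with hm
      let χ : ℝ → ℝ := fun t => ψ t - m * ψ₀ t
      have hχs : tsupport χ ⊆ tsupport ψ ∪ tsupport ψ₀ := by
        refine closure_minimal (fun t ht => ?_)
          ((isClosed_tsupport _).union (isClosed_tsupport _))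
        by_contra hn
        rw [mem_union, not_or] at hn
        refine ht ?_
        simp only [χ]
        rw [image_eq_zero_of_notMem_tsupport hn.1, image_eq_zero_of_notMem_tsupport hn.2]
        simp
      obtain ⟨φ, h1, h2, h3, h4⟩ := exists_primitive_test (T := T) (χ := χ)
        (hψ.sub (contDiff_const.mul hψ₀))
        ((hc.isCompact.union hψ₀c.isCompact).of_isClosed_subset (isClosed_tsupport _) hχs)
        (hχs.trans (union_subset hs hψ₀s)) (by
          simp only [χ]
          rw [integral_sub (hψ.continuous.integrable_of_hasCompactSupport hc)
            ((hψ₀.continuous.integrable_of_hasCompactSupport hψ₀c).const_mul m),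
            integral_const_mul, hψ₀1, mul_one, sub_self])
      have hm₀ : Integrable (fun t => m • ψ₀ t • h t) (timeMeasure T) :=
        (hint ψ₀ hψ₀.continuous hψ₀c).smul m
      have h5 := H φ h1 h2 h3
      rw [h4] at h5
      simp only [χ, sub_smul, mul_smul] at h5
      rw [integral_sub (hint ψ hψ.continuous hc) hm₀, integral_smul, sub_eq_zero] at h5
      simp only [smul_sub]
      rw [integral_sub (hint ψ hψ.continuous hc) (hψi.smul_const c), h5, integral_smul_const,
        integral_timeMeasure_of_tsupport_subset hs, sub_self])
  filter_upwards [key, ae_restrict_mem measurableSet_Ioo] with t ht hm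
  exact sub_eq_zero.mp (ht hm)

end DuBoisReymond

/-! ### Completeness of `X` and density of smooth functions -/

section Density

variable {V H : Type*} [NormedAddCommGroup V] [InnerProductSpace ℝ V]
  [NormedAddCommGroup H] [InnerProductSpace ℝ H] {T : ℝ}

theorem continuous_integral_test_smul {F : Type*} [NormedAddCommGroup F] [NormedSpace ℝ F]
    [CompleteSpace F] {ψ : ℝ → ℝ} (hψ : Continuous ψ) :
    Continuous fun f : Lp F 2 (timeMeasure T) => ∫ t, ψ t • f t ∂timeMeasure T := by
  have hm : MemLp ψ 2 (timeMeasure T) := memLp_timeMeasure_of_continuous hψ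
  have e : (fun f : Lp F 2 (timeMeasure T) => ∫ t, ψ t • f t ∂timeMeasure T) =
      fun f => ContinuousLinearMap.lpPairing (timeMeasure T) 2 2
        (ContinuousLinearMap.lsmul ℝ ℝ : ℝ →L[ℝ] F →L[ℝ] F) (hm.toLp ψ) f := by
    funext f
    rw [ContinuousLinearMap.lpPairing_eq_integral]
    refine integral_congr_ae ?_
    filter_upwards [hm.coeFn_toLp] with t ht
    rw [ht]
    rfl
  rw [e]
  exact ContinuousLinearMap.continuous _

theorem isClosed_spaceX (ι : V →L[ℝ] H) (T : ℝ) :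
    IsClosed (spaceX ι T : Set (WithLp 2 (SpaceY V T × SpaceYStar V T))) := by
  have e : (spaceX ι T : Set (WithLp 2 (SpaceY V T × SpaceYStar V T))) =
      ⋂ (φ : ℝ → ℝ) (_ : ContDiff ℝ ∞ φ) (_ : HasCompactSupport φ) (_ : tsupport φ ⊆ Ioo 0 T),
        {p | ∫ t, deriv φ t • (gelfand ι).compLp p.fst t ∂timeMeasure T =
          - ∫ t, φ t • p.snd t ∂timeMeasure T} := by
    ext p
    simp only [mem_iInter]
    refine forall_congr' fun φ => forall_congr' fun hφ => forall_congr' fun hc =>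
      forall_congr' fun hs => ?_
    have : ∫ t, deriv φ t • (gelfand ι).compLp p.fst t ∂timeMeasure T =
        ∫ t, deriv φ t • gelfand ι (p.fst t) ∂timeMeasure T := by
      refine integral_congr_ae ?_
      filter_upwards [(gelfand ι).coeFn_compLp p.fst] with t ht
      rw [ht]
    rw [mem_ofPred_eq, this]
  rw [e]
  refine isClosed_iInter fun φ => isClosed_iInter fun hφ => isClosed_iInter fun hc =>
    isClosed_iInter fun hs => isClosed_eq ?_ ?_
  · exact (continuous_integral_test_smul (hφ.continuous_deriv (by simp))).comp
      (((gelfand ι).compLpL 2 (timeMeasure T)).continuous.comp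
        (WithLp.fstL 2 ℝ (SpaceY V T) (SpaceYStar V T)).continuous)
  · exact ((continuous_integral_test_smul hφ.continuous).comp
      (WithLp.sndL 2 ℝ (SpaceY V T) (SpaceYStar V T)).continuous).neg

instance [CompleteSpace V] (ι : V →L[ℝ] H) (T : ℝ) : CompleteSpace (spaceX ι T) :=
  (isClosed_spaceX ι T).completeSpace_coe

theorem ext_spaceX {ι : V →L[ℝ] H} {u v : spaceX ι T}
    (h : embXY ι T u =ᵐ[timeMeasure T] embXY ι T v) : u = v :=
  embXY_injective ι T (Lp.ext h)

variable (V T) in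
/-- The class in `Y` of a continuous function. -/
def contToY : C(ℝ, V) →ₗ[ℝ] SpaceY V T where
  toFun g := (memLp_timeMeasure_of_continuous g.continuous).toLp _
  map_add' f g := MemLp.toLp_add (memLp_timeMeasure_of_continuous f.continuous)
    (memLp_timeMeasure_of_continuous g.continuous)
  map_smul' c f := MemLp.toLp_const_smul c (memLp_timeMeasure_of_continuous f.continuous)

theorem coeFn_contToY (g : C(ℝ, V)) : contToY V T g =ᵐ[timeMeasure T] g :=
  (memLp_timeMeasure_of_continuous g.continuous).coeFn_toLp

theorem denseRange_contToY : DenseRange (contToY V T) := by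
  intro y
  rw [Metric.mem_closure_iff]
  intro ε hε
  obtain ⟨g, -, hg, hgc, hgm⟩ := (Lp.memLp y).exists_hasCompactSupport_eLpNorm_sub_le
    (by simp) (ε := ENNReal.ofReal (ε / 2)) (by simpa using hε)
  refine ⟨_, ⟨⟨g, hgc⟩, rfl⟩, ?_⟩
  have h1 : dist y (contToY V T ⟨g, hgc⟩) =
      (eLpNorm (⇑y - g) 2 (timeMeasure T)).toReal := by
    rw [Lp.dist_def]
    congr 1
    refine eLpNorm_congr_ae ?_
    filter_upwards [coeFn_contToY (T := T) ⟨g, hgc⟩] with t ht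
    rw [Pi.sub_apply, Pi.sub_apply, ht]
    rfl
  rw [h1]
  refine lt_of_le_of_lt (ENNReal.toReal_mono (by simp) hg) ?_
  rw [ENNReal.toReal_ofReal (by positivity)]
  linarith

theorem gelfand_injective {ι : V →L[ℝ] H} (hι : Function.Injective ι) :
    Function.Injective (gelfand ι) := by
  rw [injective_iff_map_eq_zero]
  intro v hv
  refine hι ?_
  rw [map_zero, ← inner_self_eq_zero (𝕜 := ℝ), ← gelfand_apply, hv]
  rfl

/-- An element of `X` with zero derivative is a constant function. -/
theorem exists_eq_const_of_timeDeriv_eq_zero (hT : 0 < T) {ι : V →L[ℝ] H}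
    (hι : Function.Injective ι) {d : spaceX ι T} (hd : timeDeriv ι T d = 0) :
    ∃ v : V, embXY ι T d =ᵐ[timeMeasure T] fun _ => v := by
  have hgi : Integrable (fun t => gelfand ι (embXY ι T d t)) (timeMeasure T) :=
    (gelfand ι).integrable_comp ((Lp.memLp (embXY ι T d)).integrable one_le_two)
  obtain ⟨c, hc⟩ := ae_eq_const_of_integral_deriv_smul_eq_zero hT hgi (by
    intro φ h1 h2 h3
    rw [hasWeakTimeDeriv_timeDeriv ι T d φ h1 h2 h3, hd]
    have : (fun t => φ t • (0 : SpaceYStar V T) t) =ᵐ[timeMeasure T] fun _ => 0 := by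
      filter_upwards [Lp.coeFn_zero (StrongDual ℝ V) 2 (timeMeasure T)] with t ht
      rw [ht, Pi.zero_apply, smul_zero]
    rw [integral_congr_ae this, integral_zero, neg_zero])
  have hne : NeZero (timeMeasure T) := ⟨by
    rw [Ne, Measure.restrict_eq_zero, Real.volume_Ioo, ENNReal.ofReal_eq_zero]
    linarith⟩
  obtain ⟨s, hs⟩ := hc.exists
  refine ⟨embXY ι T d s, ?_⟩
  filter_upwards [hc] with t h1
  exact gelfand_injective hι (h1.trans hs.symm)

section Primitive

variable [CompleteSpace V]

/-- The primitive `t ↦ ∫₀ᵗ g` of a continuous function. -/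
def primC1 : C(ℝ, V) →ₗ[ℝ] C1Fun V where
  toFun g := ⟨fun t => ∫ s in (0 : ℝ)..t, g s, by
    have hd : ∀ t, HasDerivAt (fun t => ∫ s in (0 : ℝ)..t, g s) (g t) t := fun t =>
      intervalIntegral.integral_hasDerivAt_right (g.continuous.intervalIntegrable _ _)
        (g.continuous.stronglyMeasurableAtFilter _ _) g.continuous.continuousAt
    refine contDiff_one_iff_deriv.mpr ⟨fun t => (hd t).differentiableAt, ?_⟩
    rw [show deriv (fun t => ∫ s in (0 : ℝ)..t, g s) = g from funext fun t => (hd t).deriv]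
    exact g.continuous⟩
  map_add' f g := Subtype.ext <| funext fun _ =>
    intervalIntegral.integral_add (f.continuous.intervalIntegrable _ _)
      (g.continuous.intervalIntegrable _ _)
  map_smul' c _ := Subtype.ext <| funext fun _ => intervalIntegral.integral_smul c _

theorem deriv_primC1 (g : C(ℝ, V)) (t : ℝ) : deriv (primC1 g).1 t = g t :=
  Continuous.deriv_integral _ g.continuous 0 t

theorem exists_norm_ofC1_primC1_le (ι : V →L[ℝ] H) (T : ℝ) :
    ∃ C : ℝ, ∀ g : C(ℝ, V), ‖(ofC1 ι T ∘ₗ primC1) g‖ ≤ C * ‖contToY V T g‖ := by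
  let one : Lp ℝ 2 (timeMeasure T) :=
    (memLp_timeMeasure_of_continuous (f := fun _ => (1 : ℝ)) continuous_const).toLp _
  let c : ℝ := (measureUnivNNReal (timeMeasure T) : ℝ) ^ (2 : ENNReal).toReal⁻¹
  refine ⟨c * ‖one‖ + ‖gelfand ι‖, fun g => ?_⟩
  have hone : one =ᵐ[timeMeasure T] fun _ => 1 := MemLp.coeFn_toLp _
  have hL1 : ∫ t, ‖g t‖ ∂timeMeasure T ≤ ‖one‖ * ‖contToY V T g‖ := by
    refine le_trans (le_of_eq (integral_congr_ae ?_)) (integral_norm_mul_norm_Lp_le one _)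
    filter_upwards [hone, coeFn_contToY (T := T) g] with t h1 h2
    simp [h1, h2]
  have hsup : ‖embXY ι T (ofC1 ι T (primC1 g))‖ ≤ c * (‖one‖ * ‖contToY V T g‖) := by
    refine Lp.norm_le_of_ae_bound (by positivity) ?_
    filter_upwards [embXY_ofC1 ι T (primC1 g), ae_restrict_mem measurableSet_Ioo] with t h1 ht
    rw [h1]
    refine le_trans ?_ hL1
    rw [integral_timeMeasure (ht.1.trans ht.2).le]
    calc ‖∫ s in (0 : ℝ)..t, g s‖ ≤ ∫ s in (0 : ℝ)..t, ‖g s‖ :=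
          intervalIntegral.norm_integral_le_integral_norm ht.1.le
      _ ≤ ∫ s in (0 : ℝ)..T, ‖g s‖ :=
          intervalIntegral.integral_mono_interval le_rfl ht.1.le ht.2.le
            (Eventually.of_forall fun _ => norm_nonneg _)
            (g.continuous.norm.intervalIntegrable _ _)
  have hder : ‖timeDeriv ι T (ofC1 ι T (primC1 g))‖ ≤ ‖gelfand ι‖ * ‖contToY V T g‖ := by
    refine Lp.norm_le_mul_norm_of_ae_le_mul ?_
    filter_upwards [timeDeriv_ofC1 ι T (primC1 g), coeFn_contToY (T := T) g] with t h1 h2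
    rw [h1, h2, deriv_primC1]
    exact (gelfand ι).le_opNorm _
  have h := norm_sq_spaceX ι T (ofC1 ι T (primC1 g))
  rw [LinearMap.comp_apply, add_mul, mul_assoc]
  refine le_trans ?_ (add_le_add hsup hder)
  refine le_of_sq_le_sq ?_ (by positivity)
  rw [h]
  nlinarith [mul_nonneg (norm_nonneg (embXY ι T (ofC1 ι T (primC1 g))))
    (norm_nonneg (timeDeriv ι T (ofC1 ι T (primC1 g))))]

/-- The primitive operator `Y → X`, `y ↦ (t ↦ ∫₀ᵗ y)`, as the extension by continuity of the
primitive of continuous functions. -/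
def primOp (ι : V →L[ℝ] H) (T : ℝ) : SpaceY V T →L[ℝ] spaceX ι T :=
  (ofC1 ι T ∘ₗ primC1).extendOfNorm (contToY V T)

theorem primOp_contToY (ι : V →L[ℝ] H) (T : ℝ) (g : C(ℝ, V)) :
    primOp ι T (contToY V T g) = ofC1 ι T (primC1 g) := by
  have h := LinearMap.extendOfNorm_eq (f := ofC1 ι T ∘ₗ primC1) (e := contToY V T)
    denseRange_contToY (exists_norm_ofC1_primC1_le ι T) g
  rw [primOp, h]
  rfl

theorem primOp_mem_closure (ι : V →L[ℝ] H) (T : ℝ) (y : SpaceY V T) :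
    primOp ι T y ∈ closure (range (ofC1 ι T)) := by
  refine map_mem_closure (primOp ι T).continuous (denseRange_contToY y) ?_
  rintro _ ⟨g, rfl⟩
  exact ⟨primC1 g, (primOp_contToY ι T g).symm⟩

theorem timeDeriv_ofC1_primC1 (ι : V →L[ℝ] H) (T : ℝ) (g : C(ℝ, V)) :
    timeDeriv ι T (ofC1 ι T (primC1 g)) =
      (gelfand ι).compLpL 2 (timeMeasure T) (contToY V T g) := by
  refine Lp.ext ?_
  filter_upwards [timeDeriv_ofC1 ι T (primC1 g), (gelfand ι).coeFn_compLpL (contToY V T g),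
    coeFn_contToY (T := T) g] with t h1 h2 h3
  rw [h1, h2, h3, deriv_primC1]

theorem timeDeriv_primOp (ι : V →L[ℝ] H) (T : ℝ) (y : SpaceY V T) :
    timeDeriv ι T (primOp ι T y) = (gelfand ι).compLpL 2 (timeMeasure T) y := by
  have hc : IsClosed {y | timeDeriv ι T (primOp ι T y) =
      (gelfand ι).compLpL 2 (timeMeasure T) y} :=
    isClosed_eq ((timeDeriv ι T).continuous.comp (primOp ι T).continuous)
      (ContinuousLinearMap.continuous _)
  refine denseRange_contToY.induction_on y hc fun g => ?_
  rw [primOp_contToY, timeDeriv_ofC1_primC1]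

/-- A function `u ∈ X` whose derivative is `V`-valued is a limit of `C¹` functions: up to a
constant, it is the primitive of its derivative. -/
theorem mem_closure_range_ofC1_of_timeDeriv_eq (hT : 0 < T) {ι : V →L[ℝ] H}
    (hι : Function.Injective ι) {u : spaceX ι T} {y : SpaceY V T}
    (hy : timeDeriv ι T u = (gelfand ι).compLpL 2 (timeMeasure T) y) :
    u ∈ closure (range (ofC1 ι T)) := by
  obtain ⟨v, hv⟩ := exists_eq_const_of_timeDeriv_eq_zero hT hι (d := u - primOp ι T y)
    (by rw [map_sub, hy, timeDeriv_primOp, sub_self])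
  let k : C1Fun V := ⟨fun _ => v, (contDiff_const : ContDiff ℝ 1 fun _ : ℝ => v)⟩
  have hk : u - primOp ι T y = ofC1 ι T k := by
    refine ext_spaceX ?_
    filter_upwards [hv, embXY_ofC1 ι T k] with t h1 h2
    rw [h1, h2]
  rw [← sub_add_cancel u (primOp ι T y), hk]
  refine map_mem_closure (f := fun x => ofC1 ι T k + x) (continuous_const.add continuous_id)
    (primOp_mem_closure ι T y) ?_
  rintro _ ⟨f, rfl⟩
  exact ⟨k + f, map_add _ _ _⟩

end Primitive

end Density

/-! ### Regularization by the resolvent of the Gram operator -/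

section Regularization

theorem compLpL_comp_apply {V : Type*} [NormedAddCommGroup V] [InnerProductSpace ℝ V] {T : ℝ}
    (A B : V →L[ℝ] V) (y : SpaceY V T) :
    (A ∘L B).compLpL 2 (timeMeasure T) y =
      A.compLpL 2 (timeMeasure T) (B.compLpL 2 (timeMeasure T) y) := by
  refine Lp.ext ?_
  filter_upwards [(A ∘L B).coeFn_compLpL y, A.coeFn_compLpL (B.compLpL 2 (timeMeasure T) y),
    B.coeFn_compLpL y] with t h1 h2 h3
  rw [h1, h2, h3]
  rfl

variable {V H : Type*} [NormedAddCommGroup V] [InnerProductSpace ℝ V] [CompleteSpace V]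
  [NormedAddCommGroup H] [InnerProductSpace ℝ H] [CompleteSpace H] {T : ℝ}

/-- The operator `G : V → V` representing the scalar product of `H`, `(G η, ζ)_V = ⟨ι η, ι ζ⟩`. -/
def gramOp (ι : V →L[ℝ] H) : V →L[ℝ] V := ContinuousLinearMap.adjoint ι ∘L ι

theorem inner_gramOp (ι : V →L[ℝ] H) (η ζ : V) :
    inner ℝ (gramOp ι η) ζ = inner ℝ (ι η) (ι ζ) :=
  ContinuousLinearMap.adjoint_inner_left ι ζ (ι η)

variable (V) in
/-- The Riesz isomorphism `V ≃ V'` as a linear (rather than conjugate-linear) map. -/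
def rieszIso : V ≃ₗᵢ[ℝ] StrongDual ℝ V where
  toFun := InnerProductSpace.toDual ℝ V
  map_add' := map_add _
  map_smul' c v := by simp
  invFun := (InnerProductSpace.toDual ℝ V).symm
  left_inv := (InnerProductSpace.toDual ℝ V).symm_apply_apply
  right_inv := (InnerProductSpace.toDual ℝ V).apply_symm_apply
  norm_map' := (InnerProductSpace.toDual ℝ V).norm_map

theorem rieszIso_apply (v w : V) : rieszIso V v w = inner ℝ v w := rfl

theorem rieszIso_symm_gelfand (ι : V →L[ℝ] H) (η : V) :
    (rieszIso V).symm (gelfand ι η) = gramOp ι η := by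
  rw [LinearIsometryEquiv.symm_apply_eq]
  ext ζ
  rw [rieszIso_apply, inner_gramOp, gelfand_apply]

variable (V T) in
/-- The Riesz isomorphism `L₂(I; V') → L₂(I; V)`, applied pointwise in time. -/
def rieszY : SpaceYStar V T →L[ℝ] SpaceY V T :=
  ((rieszIso V).symm.toContinuousLinearEquiv :
    StrongDual ℝ V →L[ℝ] V).compLpL 2 (timeMeasure T)

variable (V T) in
/-- The inverse Riesz isomorphism `L₂(I; V) → L₂(I; V')`, applied pointwise in time. -/
def dualY : SpaceY V T →L[ℝ] SpaceYStar V T :=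
  ((rieszIso V).toContinuousLinearEquiv :
    V →L[ℝ] StrongDual ℝ V).compLpL 2 (timeMeasure T)

theorem coeFn_rieszY (w : SpaceYStar V T) :
    rieszY V T w =ᵐ[timeMeasure T] fun t => (rieszIso V).symm (w t) :=
  ContinuousLinearMap.coeFn_compLpL _ _

theorem coeFn_dualY (y : SpaceY V T) :
    dualY V T y =ᵐ[timeMeasure T] fun t => rieszIso V (y t) :=
  ContinuousLinearMap.coeFn_compLpL _ _

theorem dualY_rieszY (w : SpaceYStar V T) : dualY V T (rieszY V T w) = w := by
  refine Lp.ext ?_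
  filter_upwards [coeFn_dualY (rieszY V T w), coeFn_rieszY w] with t h1 h2
  rw [h1, h2, LinearIsometryEquiv.apply_symm_apply]

theorem norm_rieszY (w : SpaceYStar V T) : ‖rieszY V T w‖ = ‖w‖ := by
  rw [Lp.norm_def, Lp.norm_def]
  congr 1
  refine eLpNorm_congr_norm_ae ?_
  filter_upwards [coeFn_rieszY w] with t h
  rw [h, LinearIsometryEquiv.norm_map]

/-- For a bounded operator `K` on `V` and `u ∈ X`, the weak derivative of `K G u` is the `V`-valued
function `K R⁻¹ u'`, where `R : V → V'` is the Riesz isomorphism: `R G` is the Gelfand embedding. -/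
theorem hasWeakTimeDeriv_compLpL_gramOp (ι : V →L[ℝ] H) (K : V →L[ℝ] V)
    {u : SpaceY V T} {w : SpaceYStar V T}
    (h : HasWeakTimeDeriv ι u w) :
    HasWeakTimeDeriv ι ((K ∘L gramOp ι).compLpL 2 (timeMeasure T) u)
      ((gelfand ι).compLpL 2 (timeMeasure T) (K.compLpL 2 (timeMeasure T) (rieszY V T w))) := by
  intro φ h1 h2 h3
  -- `S` carries the relation between `u` and `w` to the one between their images.
  let S : StrongDual ℝ V →L[ℝ] StrongDual ℝ V := gelfand ι ∘L K ∘L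
    ((rieszIso V).symm.toContinuousLinearEquiv : StrongDual ℝ V →L[ℝ] V)
  have hS : ∀ f, S f = gelfand ι (K ((rieszIso V).symm f)) := fun _ => rfl
  have e1 : (fun t => deriv φ t • gelfand ι ((K ∘L gramOp ι).compLpL 2 (timeMeasure T) u t))
      =ᵐ[timeMeasure T] fun t => S (deriv φ t • gelfand ι (u t)) := by
    filter_upwards [(K ∘L gramOp ι).coeFn_compLpL (p := 2) u] with t ht
    rw [ht, map_smul, hS, rieszIso_symm_gelfand]
    rfl
  have e2 : (fun t => φ t • (gelfand ι).compLpL 2 (timeMeasure T)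
      (K.compLpL 2 (timeMeasure T) (rieszY V T w)) t)
      =ᵐ[timeMeasure T] fun t => S (φ t • w t) := by
    filter_upwards [(gelfand ι).coeFn_compLpL (K.compLpL 2 (timeMeasure T) (rieszY V T w)),
      K.coeFn_compLpL (rieszY V T w), coeFn_rieszY w] with t ht1 ht2 ht3
    rw [ht1, ht2, ht3, map_smul, hS]
  rw [integral_congr_ae e1, integral_congr_ae e2,
    S.integral_comp_comm (integrable_test_smul_gelfand ι (h1.continuous_deriv (by simp)) h2.deriv u),
    S.integral_comp_comm (integrable_test_smul h1.continuous h2 w), h φ h1 h2 h3, map_neg]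

/-- There are operators `K n = (G + 1 / (n + 1))⁻¹` on `V` for which `K n G → 1` strongly
on `L₂(I; V)`. -/
theorem exists_regularization {ι : V →L[ℝ] H} (hι : Function.Injective ι) (T : ℝ) :
    ∃ K : ℕ → V →L[ℝ] V, (∀ n v, K n (gramOp ι v) = gramOp ι (K n v)) ∧
      ∀ y : SpaceY V T, Tendsto (fun n => (K n ∘L gramOp ι).compLpL 2 (timeMeasure T) y) atTop
        (𝓝 y) := by
  have hpos : ∀ v, 0 ≤ inner ℝ (gramOp ι v) v := fun v => by
    rw [inner_gramOp]
    exact real_inner_self_nonneg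
  have hsymm : ∀ v w, inner ℝ (gramOp ι v) w = inner ℝ v (gramOp ι w) := fun v w => by
    rw [inner_gramOp, real_inner_comm, ← inner_gramOp, real_inner_comm]
  have hinj : ∀ v, gramOp ι v = 0 → v = 0 := fun v hv => by
    refine hι ?_
    rw [map_zero, ← inner_self_eq_zero (𝕜 := ℝ), ← inner_gramOp, hv, inner_zero_left]
  let ε : ℕ → ℝ := fun n => 1 / ((n : ℝ) + 1)
  have hε : ∀ n, 0 < ε n := fun n => Nat.one_div_pos_of_nat
  choose K hK hK' using fun n => exists_resolvent hpos (hε n)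
  refine ⟨K, fun n v => ?_, fun y => ?_⟩
  · have h1 := hK n v
    have h2 := hK' n v
    rw [map_add, map_smul] at h1
    exact add_right_cancel (h1.trans h2.symm)
  · simp only [compLpL_comp_apply]
    refine tendsto_resolvent_comp (G := (gramOp ι).compLpL 2 (timeMeasure T))
      (K := fun n => (K n).compLpL 2 (timeMeasure T)) ?_ ?_ ?_ hε
      tendsto_one_div_add_atTop_nhds_zero_nat ?_ ?_ y
    · intro x z
      rw [L2.inner_def, L2.inner_def]
      refine integral_congr_ae ?_
      filter_upwards [(gramOp ι).coeFn_compLpL x, (gramOp ι).coeFn_compLpL z] with t h1 h2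
      rw [h1, h2, hsymm]
    · intro x
      rw [L2.inner_def]
      refine integral_nonneg_of_ae ?_
      filter_upwards [(gramOp ι).coeFn_compLpL x] with t h1
      rw [h1]
      exact hpos _
    · rw [injective_iff_map_eq_zero]
      intro x hx
      rw [Lp.eq_zero_iff_ae_eq_zero] at hx ⊢
      filter_upwards [(gramOp ι).coeFn_compLpL x, hx] with t h1 h2
      exact hinj _ (h1.symm.trans h2)
    · intro n x
      refine Lp.ext ?_
      filter_upwards [(K n).coeFn_compLpL ((gramOp ι).compLpL 2 (timeMeasure T) x + ε n • x),
        Lp.coeFn_add ((gramOp ι).compLpL 2 (timeMeasure T) x) (ε n • x),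
        Lp.coeFn_smul (ε n) x, (gramOp ι).coeFn_compLpL x] with t h1 h2 h3 h4
      rw [h1, h2, Pi.add_apply, h3, Pi.smul_apply, h4, hK]
    · intro n x
      refine Lp.ext ?_
      filter_upwards [Lp.coeFn_add ((gramOp ι).compLpL 2 (timeMeasure T)
          ((K n).compLpL 2 (timeMeasure T) x)) (ε n • (K n).compLpL 2 (timeMeasure T) x),
        Lp.coeFn_smul (ε n) ((K n).compLpL 2 (timeMeasure T) x),
        (gramOp ι).coeFn_compLpL ((K n).compLpL 2 (timeMeasure T) x),
        (K n).coeFn_compLpL x] with t h1 h2 h3 h4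
      rw [h1, Pi.add_apply, h2, Pi.smul_apply, h3, h4, hK']

/-- The `C¹` functions are dense in `X`: every `u ∈ X` is the limit of the functions
`(G + ε)⁻¹ G u`, whose derivatives are `V`-valued. -/
theorem denseRange_ofC1 (hT : 0 < T) {ι : V →L[ℝ] H} (hι : Function.Injective ι) :
    DenseRange (ofC1 ι T) := by
  intro u
  obtain ⟨K, hKc, hK⟩ := exists_regularization hι T
  let x : ℕ → spaceX ι T := fun n => ⟨WithLp.toLp 2 (_, _),
    hasWeakTimeDeriv_compLpL_gramOp ι (K n) (hasWeakTimeDeriv_timeDeriv ι T u)⟩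
  have hx : Tendsto x atTop (𝓝 u) := by
    refine tendsto_spaceX (hK _) ?_
    have h1 := ((dualY V T).continuous.tendsto _).comp (hK (rieszY V T (timeDeriv ι T u)))
    rw [dualY_rieszY] at h1
    refine h1.congr fun n => Lp.ext ?_
    set z := rieszY V T (timeDeriv ι T u) with hz
    change dualY V T ((K n ∘L gramOp ι).compLpL 2 (timeMeasure T) z) =ᵐ[timeMeasure T]
      (gelfand ι).compLpL 2 (timeMeasure T) ((K n).compLpL 2 (timeMeasure T) z)
    filter_upwards [coeFn_dualY ((K n ∘L gramOp ι).compLpL 2 (timeMeasure T) z),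
      (K n ∘L gramOp ι).coeFn_compLpL z,
      (gelfand ι).coeFn_compLpL ((K n).compLpL 2 (timeMeasure T) z),
      (K n).coeFn_compLpL z] with t h1 h2 h3 h4
    rw [h1, h2, h3, h4, ContinuousLinearMap.comp_apply, hKc, ← rieszIso_symm_gelfand,
      LinearIsometryEquiv.apply_symm_apply]
  exact isClosed_closure.mem_of_tendsto hx
    (Eventually.of_forall fun n => mem_closure_range_ofC1_of_timeDeriv_eq hT hι rfl)

end Regularization

/-! ### The embedding into `C([0, T]; H)` and integration by parts -/

section Trace

variable {V H : Type*} [NormedAddCommGroup V] [InnerProductSpace ℝ V]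
  [NormedAddCommGroup H] [InnerProductSpace ℝ H] {T : ℝ}

theorem C1Fun.integral_gelfand_deriv (ι : V →L[ℝ] H) (f g : C1Fun V) (s t : ℝ) :
    ∫ r in s..t, (gelfand ι (deriv f.1 r) (g.1 r) + gelfand ι (deriv g.1 r) (f.1 r)) =
      inner ℝ (ι (f.1 t)) (ι (g.1 t)) - inner ℝ (ι (f.1 s)) (ι (g.1 s)) := by
  have hf : ∀ r, HasDerivAt (fun r => ι (f.1 r)) (ι (deriv f.1 r)) r := fun r =>
    ι.hasFDerivAt.comp_hasDerivAt r (f.hasDerivAt r)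
  have hg : ∀ r, HasDerivAt (fun r => ι (g.1 r)) (ι (deriv g.1 r)) r := fun r =>
    ι.hasFDerivAt.comp_hasDerivAt r (g.hasDerivAt r)
  refine intervalIntegral.integral_eq_sub_of_hasDerivAt
    (f := fun r => inner ℝ (ι (f.1 r)) (ι (g.1 r))) (fun r _ => ?_) ?_
  · have h := (hf r).inner ℝ (hg r)
    refine h.congr_deriv ?_
    rw [gelfand_apply, gelfand_apply, add_comm, real_inner_comm (ι (f.1 r))]
  · refine Continuous.intervalIntegrable ?_ _ _
    have c1 := ι.continuous.comp f.continuous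
    have c2 := ι.continuous.comp g.continuous
    have c3 := ι.continuous.comp f.continuous_deriv
    have c4 := ι.continuous.comp g.continuous_deriv
    exact (c3.inner c2).add (c4.inner c1)

/-- The trace inequality for `C¹` functions, from
`‖u(t)‖² = ‖u(s)‖² + 2 ∫ₛᵗ ⟨u', u⟩` by averaging over `s`. -/
theorem C1Fun.mul_norm_sq_le (ι : V →L[ℝ] H) (hT : 0 < T) (f : C1Fun V) {t : ℝ}
    (ht : t ∈ Icc 0 T) :
    T * ‖ι (f.1 t)‖ ^ 2 ≤ (‖ι‖ ^ 2 + 2 * T) * ‖ofC1 ι T f‖ ^ 2 := by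
  set u := ofC1 ι T f with hu
  set q : ℝ → ℝ := fun r => gelfand ι (deriv f.1 r) (f.1 r) with hq
  have hqc : Continuous q := by
    have c1 := ι.continuous.comp f.continuous
    have c3 := ι.continuous.comp f.continuous_deriv
    exact c3.inner c1
  have hqI : ∫ r, ‖q r‖ ∂timeMeasure T ≤ ‖u‖ ^ 2 := by
    calc ∫ r, ‖q r‖ ∂timeMeasure T
        ≤ ∫ r, ‖timeDeriv ι T u r‖ * ‖embXY ι T u r‖ ∂timeMeasure T := by
          refine integral_mono_ae ((memLp_timeMeasure_of_continuous hqc).integrable one_le_two).norm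
            (integrable_norm_mul_norm_Lp _ _) ?_
          filter_upwards [timeDeriv_ofC1 ι T f, embXY_ofC1 ι T f] with r h1 h2
          rw [h1, h2]
          exact (gelfand ι (deriv f.1 r)).le_opNorm _
      _ ≤ ‖timeDeriv ι T u‖ * ‖embXY ι T u‖ := integral_norm_mul_norm_Lp_le _ _
      _ ≤ ‖u‖ ^ 2 := by
          rw [sq]
          exact mul_le_mul (norm_timeDeriv_le ι T u) (norm_embXY_le ι T u) (norm_nonneg _)
            (norm_nonneg _)
  have hpt : ∀ s ∈ Icc 0 T, ‖ι (f.1 t)‖ ^ 2 ≤ ‖ι (f.1 s)‖ ^ 2 + 2 * ‖u‖ ^ 2 := by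
    intro s hs
    have h1 := C1Fun.integral_gelfand_deriv ι f f s t
    rw [real_inner_self_eq_norm_sq, real_inner_self_eq_norm_sq,
      intervalIntegral.integral_add (hqc.intervalIntegrable _ _) (hqc.intervalIntegrable _ _)]
      at h1
    have h2 : ∫ r in s..t, q r ≤ ‖u‖ ^ 2 := by
      refine (Real.le_norm_self _).trans (le_trans ?_ hqI)
      refine le_trans intervalIntegral.norm_integral_le_integral_norm_uIoc ?_
      rw [integral_timeMeasure hT.le, intervalIntegral.integral_of_le hT.le]
      refine setIntegral_mono_set (hqc.norm.integrableOn_Ioc)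
        (Eventually.of_forall fun _ => norm_nonneg _) (Eventually.of_forall ?_)
      exact Ioc_subset_Ioc (le_min hs.1 ht.1) (max_le hs.2 ht.2)
    linarith
  have hι : ∫ s, ‖ι (f.1 s)‖ ^ 2 ∂timeMeasure T ≤ ‖ι‖ ^ 2 * ‖u‖ ^ 2 := by
    calc ∫ s, ‖ι (f.1 s)‖ ^ 2 ∂timeMeasure T
        ≤ ∫ s, ‖ι‖ ^ 2 * (‖embXY ι T u s‖ * ‖embXY ι T u s‖) ∂timeMeasure T := by
          refine integral_mono_ae ((memLp_timeMeasure_of_continuous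
            ((ι.continuous.comp f.continuous).norm.pow 2)).integrable one_le_two)
            ((integrable_norm_mul_norm_Lp _ _).const_mul _) ?_
          filter_upwards [embXY_ofC1 ι T f] with s h1
          rw [h1, ← sq, ← mul_pow]
          exact pow_le_pow_left₀ (norm_nonneg _) (ι.le_opNorm _) 2
      _ ≤ ‖ι‖ ^ 2 * (‖embXY ι T u‖ * ‖embXY ι T u‖) := by
          rw [integral_const_mul]
          exact mul_le_mul_of_nonneg_left (integral_norm_mul_norm_Lp_le _ _) (sq_nonneg _)
      _ ≤ ‖ι‖ ^ 2 * ‖u‖ ^ 2 := by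
          refine mul_le_mul_of_nonneg_left ?_ (sq_nonneg _)
          rw [← sq]
          exact pow_le_pow_left₀ (norm_nonneg _) (norm_embXY_le ι T u) 2
  have hvol : (timeMeasure T).real univ = T := by
    simp [Measure.real, hT.le]
  have hi : Integrable (fun s => ‖ι (f.1 s)‖ ^ 2) (timeMeasure T) :=
    (memLp_timeMeasure_of_continuous ((ι.continuous.comp f.continuous).norm.pow 2)).integrable
      one_le_two
  have hmono : ∫ _ : ℝ, ‖ι (f.1 t)‖ ^ 2 ∂timeMeasure T ≤
      ∫ s, (‖ι (f.1 s)‖ ^ 2 + 2 * ‖u‖ ^ 2) ∂timeMeasure T := by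
    refine integral_mono_ae (integrable_const _) (hi.add (integrable_const _)) ?_
    filter_upwards [ae_restrict_mem measurableSet_Ioo] with s hs
    exact hpt s (Ioo_subset_Icc_self hs)
  rw [integral_add hi (integrable_const _), integral_const, integral_const, hvol, smul_eq_mul,
    smul_eq_mul] at hmono
  linarith

variable (T) in
/-- The restriction to `[0, T]` of a `C¹` function, with values in `H`. -/
def restrictC1 (ι : V →L[ℝ] H) : C1Fun V →ₗ[ℝ] C(Icc (0 : ℝ) T, H) where
  toFun f := ⟨fun t => ι (f.1 t), ι.continuous.comp (f.continuous.comp continuous_subtype_val)⟩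
  map_add' f g := by
    ext t
    exact map_add ι (f.1 t) (g.1 t)
  map_smul' c f := by
    ext t
    exact map_smul ι c (f.1 t)

theorem exists_norm_restrictC1_le (hT : 0 < T) (ι : V →L[ℝ] H) :
    ∃ C : ℝ, ∀ f : C1Fun V, ‖restrictC1 T ι f‖ ≤ C * ‖ofC1 ι T f‖ := by
  refine ⟨√((‖ι‖ ^ 2 + 2 * T) / T), fun f => ?_⟩
  refine (ContinuousMap.norm_le _ (by positivity)).mpr fun t => ?_
  refine le_of_sq_le_sq ?_ (by positivity)
  rw [mul_pow, Real.sq_sqrt (by positivity), div_mul_eq_mul_div, le_div_iff₀ hT, mul_comm]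
  exact f.mul_norm_sq_le ι hT t.2

variable [CompleteSpace V] [CompleteSpace H]

/-- The extension by continuity to `X` of the restriction of `C¹` functions to `[0, T]`. -/
def extendRestrictC1 (ι : V →L[ℝ] H) (T : ℝ) : spaceX ι T →L[ℝ] C(Icc (0 : ℝ) T, H) :=
  (restrictC1 T ι).extendOfNorm (ofC1 ι T)

theorem extendRestrictC1_ofC1 (hT : 0 < T) {ι : V →L[ℝ] H} (hι : Function.Injective ι)
    (f : C1Fun V) : extendRestrictC1 ι T (ofC1 ι T f) = restrictC1 T ι f := by
  have h := LinearMap.extendOfNorm_eq (f := restrictC1 T ι) (e := ofC1 ι T)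
    (denseRange_ofC1 hT hι) (exists_norm_restrictC1_le hT ι) f
  rw [extendRestrictC1, h]

theorem isContEmbedding_extendRestrictC1 (hT : 0 < T) {ι : V →L[ℝ] H}
    (hι : Function.Injective ι) : IsContEmbedding ι T (extendRestrictC1 ι T) := by
  intro u
  -- A sequence of `C¹` functions converging to `u` in `X` converges uniformly to the extension
  -- and, along a subsequence, almost everywhere to `u`.
  obtain ⟨x, hx, hxu⟩ := mem_closure_iff_seq_limit.mp (denseRange_ofC1 hT hι u)
  choose f hf using hx
  have hY : Tendsto (fun n => embXY ι T (x n)) atTop (𝓝 (embXY ι T u)) :=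
    ((embXY ι T).continuous.tendsto u).comp hxu
  obtain ⟨ns, hns, hae⟩ := (tendstoInMeasure_of_tendsto_Lp hY).exists_seq_tendsto_ae
  have hfae : ∀ᵐ t ∂timeMeasure T, ∀ n, embXY ι T (x n) t = (f n).1 t := by
    rw [ae_all_iff]
    intro n
    rw [← hf n]
    exact embXY_ofC1 ι T (f n)
  filter_upwards [hae, hfae] with t h1 h2 ht
  have hΓt : Tendsto (fun n => extendRestrictC1 ι T (x (ns n)) ⟨t, ht⟩) atTop 
      (𝓝 (extendRestrictC1 ι T u ⟨t, ht⟩)) :=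
    (((ContinuousMap.evalCLM ℝ (⟨t, ht⟩ : Icc (0 : ℝ) T)).continuous.comp
      (extendRestrictC1 ι T).continuous).tendsto u).comp (hxu.comp hns.tendsto_atTop)
  refine tendsto_nhds_unique hΓt (((ι.continuous.tendsto _).comp h1).congr fun n => ?_)
  rw [Function.comp_apply, h2, ← hf (ns n), extendRestrictC1_ofC1 hT hι]
  rfl

theorem isContEmbedding_contEmb (hT : 0 < T) {ι : V →L[ℝ] H} (hι : Function.Injective ι) :
    IsContEmbedding ι T (contEmb ι T) := by
  have h : ∃ Γ, IsContEmbedding ι T Γ := 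
    ⟨_, isContEmbedding_extendRestrictC1 hT hι⟩
  rw [contEmb, dif_pos h]
  exact h.choose_spec

theorem trace_ofC1 (hT : 0 < T) {ι : V →L[ℝ] H} (hι : Function.Injective ι) (t : Icc (0 : ℝ) T)
    (f : C1Fun V) : trace ι T t (ofC1 ι T f) = ι (f.1 t) := by
  have e : contEmb ι T = extendRestrictC1 ι T :=
    IsContEmbedding.unique hT (isContEmbedding_contEmb hT hι)
      (isContEmbedding_extendRestrictC1 hT hι)
  change contEmb ι T (ofC1 ι T f) t = _
  rw [e, extendRestrictC1_ofC1 hT hι]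
  rfl

theorem opDt_ofC1_add_opDt_ofC1 (hT : 0 < T) {ι : V →L[ℝ] H} (hι : Function.Injective ι)
    {t0 tT : Icc (0 : ℝ) T} (ht0 : (t0 : ℝ) = 0) (htT : (tT : ℝ) = T) (f g : C1Fun V) :
    opDt ι T (ofC1 ι T f) (embXY ι T (ofC1 ι T g)) +
        opDt ι T (ofC1 ι T g) (embXY ι T (ofC1 ι T f)) =
      inner ℝ (trace ι T tT (ofC1 ι T f)) (trace ι T tT (ofC1 ι T g)) -
        inner ℝ (trace ι T t0 (ofC1 ι T f)) (trace ι T t0 (ofC1 ι T g)) := by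
  have hi : ∀ f g : C1Fun V, Integrable (fun r => gelfand ι (deriv f.1 r) (g.1 r))
      (timeMeasure T) := fun f g =>
    (memLp_timeMeasure_of_continuous ((ι.continuous.comp f.continuous_deriv).inner
      (ι.continuous.comp g.continuous))).integrable one_le_two
  have he : ∀ f g : C1Fun V, opDt ι T (ofC1 ι T f) (embXY ι T (ofC1 ι T g)) =
      ∫ r, gelfand ι (deriv f.1 r) (g.1 r) ∂timeMeasure T := by
    intro f g
    rw [opDt_apply]
    refine integral_congr_ae ?_
    filter_upwards [timeDeriv_ofC1 ι T f, embXY_ofC1 ι T g] with r h1 h2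
    rw [h1, h2]
  rw [he, he, ← integral_add (hi f g) (hi g f), integral_timeMeasure hT.le,
    C1Fun.integral_gelfand_deriv, trace_ofC1 hT hι, trace_ofC1 hT hι, trace_ofC1 hT hι,
    trace_ofC1 hT hι, ht0, htT]

/-- Integration by parts in `X`. -/
theorem opDt_add_opDt (hT : 0 < T) {ι : V →L[ℝ] H} (hι : Function.Injective ι)
    {t0 tT : Icc (0 : ℝ) T} (ht0 : (t0 : ℝ) = 0) (htT : (tT : ℝ) = T) (u v : spaceX ι T) :
    opDt ι T u (embXY ι T v) + opDt ι T v (embXY ι T u) =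
      inner ℝ (trace ι T tT u) (trace ι T tT v) - inner ℝ (trace ι T t0 u) (trace ι T t0 v) := by
  -- Both sides are continuous bilinear forms in `(u, v)`.
  let L : spaceX ι T →L[ℝ] StrongDual ℝ (spaceX ι T) := restrictX ι T ∘L opDt ι T
  let R : Icc (0 : ℝ) T → spaceX ι T →L[ℝ] StrongDual ℝ (spaceX ι T) := fun t =>
    traceDual ι T t ∘L trace ι T t
  have hd := denseRange_ofC1 hT hι
  have h : L + L.flip = R tT - R t0 := by
    refine ContinuousLinearMap.coeFn_injective
      (hd.equalizer (ContinuousLinearMap.continuous _) (ContinuousLinearMap.continuous _)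
        (funext fun f => ContinuousLinearMap.coeFn_injective
          (hd.equalizer (ContinuousLinearMap.continuous _) (ContinuousLinearMap.continuous _)
            (funext fun g => ?_))))
    have := opDt_ofC1_add_opDt_ofC1 hT hι ht0 htT f g
    rw [← traceDual_apply, ← traceDual_apply] at this
    exact this
  have := congrArg (fun A => A u v) h
  rw [← traceDual_apply, ← traceDual_apply]
  exact this

end Trace

/-! ### Injectivity of the adjoint problem -/

section Coercive

variable {V : Type*} [NormedAddCommGroup V] [InnerProductSpace ℝ V] {T : ℝ}

theorem norm_sq_spaceY (u : SpaceY V T) : ‖u‖ ^ 2 = ∫ t, ‖u t‖ ^ 2 ∂timeMeasure T := by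
  rw [← real_inner_self_eq_norm_sq, L2.inner_def]
  simp only [real_inner_self_eq_norm_sq]

theorem exists_le_opA_self (a : CoerciveFamily V T) :
    ∃ α : ℝ, 0 < α ∧ ∀ u, α * ‖u‖ ^ 2 ≤ opA a u u := by
  obtain ⟨α, hα, h⟩ := a.coercive
  refine ⟨α, hα, fun u => ?_⟩
  rw [norm_sq_spaceY, ← integral_const_mul, opA_apply]
  have hi : Integrable (fun t => ‖u t‖ ^ 2) (timeMeasure T) :=
    (Lp.memLp u).norm.integrable_sq
  refine integral_mono_ae (hi.const_mul α) (a.integrable_comp u u) ?_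
  filter_upwards [h] with t ht
  exact ht _

end Coercive

section Adjoint

variable {V H : Type*} [NormedAddCommGroup V] [InnerProductSpace ℝ V] [CompleteSpace V]
  [NormedAddCommGroup H] [InnerProductSpace ℝ H] {T : ℝ}

variable (V T) in
theorem rieszY_dualY (y : SpaceY V T) : rieszY V T (dualY V T y) = y := by
  refine Lp.ext ?_
  filter_upwards [coeFn_rieszY (dualY V T y), coeFn_dualY y] with t h1 h2
  rw [h1, h2, LinearIsometryEquiv.symm_apply_apply]

theorem opDt_eq_inner (ι : V →L[ℝ] H) (u : spaceX ι T) (v : SpaceY V T) :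
    opDt ι T u v = inner ℝ (rieszY V T (timeDeriv ι T u)) v := by
  rw [opDt_apply, L2.inner_def]
  refine integral_congr_ae ?_
  filter_upwards [coeFn_rieszY (timeDeriv ι T u)] with t h
  rw [h, ← rieszIso_apply, LinearIsometryEquiv.apply_symm_apply]

theorem norm_timeDeriv_le_norm_opDt (ι : V →L[ℝ] H) (u : spaceX ι T) :
    ‖timeDeriv ι T u‖ ≤ ‖opDt ι T u‖ := by
  rw [← norm_rieszY]
  set z := rieszY V T (timeDeriv ι T u) with hz
  rcases eq_or_ne z 0 with h0 | h0
  · rw [h0, norm_zero]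
    exact norm_nonneg (opDt ι T u)
  refine le_of_mul_le_mul_right ?_ (norm_pos_iff.mpr h0)
  rw [← real_inner_self_eq_norm_mul_norm, hz, ← opDt_eq_inner, ← hz]
  exact (Real.le_norm_self _).trans ((opDt ι T u).le_opNorm z)

/-- The isometric embedding of `X` into the Hilbert space `Y × Y`, `u ↦ (u, R⁻¹ u')`. -/
def isometryX (ι : V →L[ℝ] H) (T : ℝ) : spaceX ι T →ₗᵢ[ℝ] WithLp 2 (SpaceY V T × SpaceY V T) where
  toFun u := WithLp.toLp 2 (embXY ι T u, rieszY V T (timeDeriv ι T u))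
  map_add' u v := by
    rw [map_add, map_add, map_add]
    rfl
  map_smul' c u := by
    rw [map_smul, map_smul, map_smul]
    rfl
  norm_map' u := by
    refine (sq_eq_sq₀ (norm_nonneg _) (norm_nonneg _)).mp ?_
    rw [norm_sq_spaceX, ← norm_rieszY]
    exact WithLp.prod_norm_sq_eq_of_L2
      (WithLp.toLp 2 (embXY ι T u, rieszY V T (timeDeriv ι T u)))

/-- If `λ ∈ Y` annihilates `B w` for all test functions `w = φ v`, then `λ' = a(t; ·, λ)` in the
weak sense; in particular `λ ∈ X`. -/
theorem hasWeakTimeDeriv_of_forall_opB_eq_zero {ι : V →L[ℝ] H} (a : CoerciveFamily V T)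
    {lam z : SpaceY V T} (hz : ∀ y, inner ℝ z y = opA a y lam)
    (hB : ∀ (φ : ℝ → ℝ) (hφ : ContDiff ℝ 1 φ) (v : V), tsupport φ ⊆ Ioo 0 T →
      opB ι a (ofC1 ι T (C1Fun.smulVec hφ v)) lam = 0) :
    HasWeakTimeDeriv ι lam (dualY V T z) := by
  intro φ hφ hc hs
  have hφ1 : ContDiff ℝ 1 φ := hφ.of_le (by exact_mod_cast le_top)
  have i1 := integrable_test_smul_gelfand ι (hφ.continuous_deriv (by simp)) hc.deriv lam
  have i2 := integrable_test_smul hφ.continuous hc (dualY V T z)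
  ext v
  rw [neg_apply, ContinuousLinearMap.integral_apply i1,
    ContinuousLinearMap.integral_apply i2]
  have h0 := hB φ hφ1 v hs
  set w := ofC1 ι T (C1Fun.smulVec hφ1 v) with hw
  have e1 : opDt ι T w lam =
      ∫ t, (deriv φ t • gelfand ι (lam t)) v ∂timeMeasure T := by
    rw [opDt_apply]
    refine integral_congr_ae ?_
    filter_upwards [timeDeriv_ofC1 ι T (C1Fun.smulVec hφ1 v)] with t h1
    rw [h1, C1Fun.deriv_smulVec, map_smul, smul_apply,
      smul_apply, gelfand_apply, gelfand_apply, real_inner_comm]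
  have e2 : opA a (embXY ι T w) lam = ∫ t, (φ t • dualY V T z t) v ∂timeMeasure T := by
    rw [← hz, L2.inner_def]
    refine integral_congr_ae ?_
    filter_upwards [embXY_ofC1 ι T (C1Fun.smulVec hφ1 v), coeFn_dualY z] with t h1 h2
    rw [h1, h2, smul_apply, rieszIso_apply]
    exact inner_smul_right _ _ _
  rw [← e1, ← e2]
  exact eq_neg_of_add_eq_zero_left h0

/-- The range of `(B, γ₀)` is dense: an annihilating pair `(λ, h)` satisfies the backward adjoint
problem `λ' = a(t; ·, λ)`, `λ(T) = 0`, `λ(0) = h`, so that coercivity forces it to vanish. -/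
theorem eq_zero_of_forall_opB_add_inner_eq_zero [CompleteSpace H] (hT : 0 < T) {ι : V →L[ℝ] H}
    (hι : Function.Injective ι) (hd : DenseRange ι) (a : CoerciveFamily V T)
    {t0 tT : Icc (0 : ℝ) T} (ht0 : (t0 : ℝ) = 0) (htT : (tT : ℝ) = T)
    {lam : SpaceY V T} {h : H}
    (hB : ∀ w, opB ι a w lam + inner ℝ h (trace ι T t0 w) = 0) : lam = 0 ∧ h = 0 := by
  set z : SpaceY V T := (rieszIso (SpaceY V T)).symm ((opA a).flip lam) with hz_def
  have hz : ∀ y, inner ℝ z y = opA a y lam := fun y => by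
    rw [← rieszIso_apply, hz_def, LinearIsometryEquiv.apply_symm_apply]
    rfl
  have hweak : HasWeakTimeDeriv ι lam (dualY V T z) := by
    refine hasWeakTimeDeriv_of_forall_opB_eq_zero a hz fun φ hφ v hs => ?_
    have h1 := hB (ofC1 ι T (C1Fun.smulVec hφ v))
    rw [trace_ofC1 hT hι, ht0] at h1
    have h2 : (C1Fun.smulVec hφ v).1 0 = 0 := by
      change φ 0 • v = 0
      rw [(eq_zero_of_tsupport_subset_Ioo hs).1, zero_smul]
    rwa [h2, map_zero, inner_zero_right, add_zero] at h1
  let l : spaceX ι T := ⟨WithLp.toLp 2 (lam, dualY V T z), hweak⟩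
  have hl : embXY ι T l = lam := rfl
  have hDt : ∀ w, opDt ι T l w = opA a w lam := fun w => by
    rw [opDt_eq_inner, ← hz]
    change inner ℝ (rieszY V T (dualY V T z)) w = _
    rw [rieszY_dualY]
  -- Integrating by parts leaves only the boundary terms.
  have hbd : ∀ w, inner ℝ (trace ι T tT l) (trace ι T tT w) +
      inner ℝ (h - trace ι T t0 l) (trace ι T t0 w) = 0 := fun w => by
    have h1 := hB w
    have h2 := opDt_add_opDt hT hι ht0 htT l w
    have h3 : opB ι a w lam = opDt ι T w lam + opA a (embXY ι T w) lam := rfl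
    rw [hDt, hl] at h2
    rw [inner_sub_left]
    linarith
  have hzero : ∀ x : H, (∀ v, inner ℝ x (ι v) = 0) → x = 0 := fun x hx => by
    refine hd.eq_zero_of_inner_left ℝ ?_
    exact hx
  -- Linear functions of time make the two boundary values vanish separately.
  have hlT : trace ι T tT l = 0 := by
    refine hzero _ fun v => ?_
    have h1 := hbd (ofC1 ι T (C1Fun.smulVec (φ := fun t => t / T) (contDiff_id.div_const T) v))
    rw [trace_ofC1 hT hι, trace_ofC1 hT hι, ht0, htT] at h1
    simpa [C1Fun.smulVec, hT.ne'] using h1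
  have hl0 : h = trace ι T t0 l := by
    rw [← sub_eq_zero]
    refine hzero _ fun v => ?_
    have h1 := hbd (ofC1 ι T (C1Fun.smulVec (φ := fun _ => 1) contDiff_const v))
    rw [hlT, inner_zero_left, zero_add, trace_ofC1 hT hι] at h1
    simpa [C1Fun.smulVec] using h1
  obtain ⟨α, hα, hcoer⟩ := exists_le_opA_self a
  have h1 := opDt_add_opDt hT hι ht0 htT l l
  rw [hDt, hl, hlT, inner_zero_left, real_inner_self_eq_norm_sq] at h1
  have h2 := hcoer lam
  have hlam : lam = 0 := by
    rw [← norm_eq_zero, ← sq_eq_zero_iff]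
    nlinarith [sq_nonneg ‖lam‖, sq_nonneg ‖trace ι T t0 l‖]
  refine ⟨hlam, ?_⟩
  have : l = 0 := embXY_injective ι T (hl.trans (hlam.trans (map_zero _).symm))
  rw [hl0, this, map_zero]

end Adjoint

/-! ### The operators `A_s`, `C' A_s⁻¹ C + A_s + γ_T' γ_T` and the block operator -/

theorem exists_bound_to_dual {E : Type*} [NormedAddCommGroup E] [NormedSpace ℝ E]
    (B : E →L[ℝ] StrongDual ℝ E) : ∃ C : ℝ, 0 < C ∧ ∀ x, ‖B x‖ ≤ C * ‖x‖ :=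
  B.bound

theorem isInvertible_prod_dual_of_bijective {E F : Type*} [NormedAddCommGroup E]
    [NormedSpace ℝ E] [CompleteSpace E] [NormedAddCommGroup F] [NormedSpace ℝ F] [CompleteSpace F]
    {A : E × F →L[ℝ] StrongDual ℝ E × StrongDual ℝ F}
    (hA : Function.Bijective A) : A.IsInvertible :=
  ⟨ContinuousLinearEquiv.ofBijective A (LinearMap.ker_eq_bot.mpr hA.1)
    (LinearMap.range_eq_top.mpr hA.2), ContinuousLinearEquiv.coe_ofBijective _ _ _⟩

section Operators

variable {V H : Type*} [NormedAddCommGroup V] [InnerProductSpace ℝ V]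
  [NormedAddCommGroup H] [InnerProductSpace ℝ H] {T : ℝ}

theorem opAs_apply (a : CoerciveFamily V T) (u v : SpaceY V T) :
    opAs a u v = 1 / 2 * (opA a u v + opA a v u) := rfl

theorem opAs_symm (a : CoerciveFamily V T) (u v : SpaceY V T) : opAs a u v = opAs a v u := by
  rw [opAs_apply, opAs_apply, add_comm]

theorem exists_le_opAs_self (a : CoerciveFamily V T) :
    ∃ α : ℝ, 0 < α ∧ ∀ u, α * ‖u‖ ^ 2 ≤ opAs a u u := by
  obtain ⟨α, hα, h⟩ := exists_le_opA_self a
  refine ⟨α, hα, fun u => (h u).trans (le_of_eq ?_)⟩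
  rw [opAs_apply]
  ring

theorem opB_eq_opC_add (ι : V →L[ℝ] H) (a : CoerciveFamily V T) (u : spaceX ι T) :
    opB ι a u = opC ι a u + opAs a (embXY ι T u) :=
  (sub_add_cancel _ _).symm

theorem opDt_eq_opC_add (ι : V →L[ℝ] H) (a : CoerciveFamily V T) (u : spaceX ι T) :
    opDt ι T u = opC ι a u + opAs a (embXY ι T u) - opA a (embXY ι T u) := by
  rw [← opB_eq_opC_add]
  exact (add_sub_cancel_right _ _).symm

theorem opAsTrace_apply (ι : V →L[ℝ] H) (a : CoerciveFamily V T) (tT : Icc (0 : ℝ) T)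
    (u v : spaceX ι T) : opAsTrace ι a tT u v =
      opAs a (embXY ι T u) (embXY ι T v) + inner ℝ (trace ι T tT u) (trace ι T tT v) := by
  rw [← traceDual_apply]
  rfl

theorem opBEN_apply (ι : V →L[ℝ] H) (a : CoerciveFamily V T) (tT : Icc (0 : ℝ) T)
    (u v : spaceX ι T) : opBEN ι a tT u v =
      opC ι a v ((opAs a).inverse (opC ι a u)) + opAsTrace ι a tT u v := rfl

theorem opSchur_apply (ι : V →L[ℝ] H) (a : CoerciveFamily V T) (t0 : Icc (0 : ℝ) T)
    (u v : spaceX ι T) : opSchur ι a t0 u v =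
      opB ι a v ((opAs a).inverse (opB ι a u)) +
        inner ℝ (trace ι T t0 u) (trace ι T t0 v) := by
  rw [← traceDual_apply]
  rfl

theorem opBlock_apply (ι : V →L[ℝ] H) (a : CoerciveFamily V T) (tT : Icc (0 : ℝ) T)
    (lam : SpaceY V T) (u : spaceX ι T) :
    opBlock ι a tT (lam, u) =
      (opAs a lam + opC ι a u, (opC ι a).flip lam - opAsTrace ι a tT u) := by
  rw [sub_eq_add_neg]
  rfl

theorem opAsTrace_symm (ι : V →L[ℝ] H) (a : CoerciveFamily V T) (tT : Icc (0 : ℝ) T)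
    (u v : spaceX ι T) : opAsTrace ι a tT u v = opAsTrace ι a tT v u := by
  rw [opAsTrace_apply, opAsTrace_apply, opAs_symm, real_inner_comm]

theorem opBlock_symm (ι : V →L[ℝ] H) (a : CoerciveFamily V T) (tT : Icc (0 : ℝ) T)
    (p q : SpaceY V T × spaceX ι T) :
    (opBlock ι a tT p).1 q.1 + (opBlock ι a tT p).2 q.2 =
      (opBlock ι a tT q).1 p.1 + (opBlock ι a tT q).2 p.2 := by
  obtain ⟨l, u⟩ := p
  obtain ⟨m, v⟩ := q
  simp only [opBlock_apply, add_apply, sub_apply, ContinuousLinearMap.flip_apply]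
  rw [opAs_symm a l m, opAsTrace_symm ι a tT u v]
  ring

theorem exists_bound_opDt_le (ι : V →L[ℝ] H) (a : CoerciveFamily V T) :
    ∃ k : ℝ, 0 ≤ k ∧ ∀ (u : spaceX ι T) (y : SpaceY V T), opC ι a u = opAs a y →
      ‖opDt ι T u‖ ≤ k * (‖y‖ + ‖embXY ι T u‖) := by
  obtain ⟨m, hm, hAs⟩ := exists_bound_to_dual (opAs a)
  obtain ⟨n, hn, hA⟩ := exists_bound_to_dual (opA a)
  refine ⟨m + n, by positivity, fun u y hy => ?_⟩
  rw [opDt_eq_opC_add ι a, hy]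
  have h5 := norm_sub_le (opAs a y + opAs a (embXY ι T u)) (opA a (embXY ι T u))
  have h6 := norm_add_le (opAs a y) (opAs a (embXY ι T u))
  have h1 := hAs y
  have h2 := hAs (embXY ι T u)
  have h3 := hA (embXY ι T u)
  have h4 := mul_nonneg hn.le (norm_nonneg y)
  linarith

variable [CompleteSpace V]

theorem isInvertible_opAs (a : CoerciveFamily V T) : (opAs a).IsInvertible := by
  obtain ⟨α, hα, h⟩ := exists_le_opAs_self a
  refine isInvertible_of_isCoercive ⟨α, hα, fun u => ?_⟩
  rw [mul_assoc, ← sq]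
  exact h u

theorem opAs_inverse_apply (a : CoerciveFamily V T) (f : StrongDual ℝ (SpaceY V T)) :
    opAs a ((opAs a).inverse f) = f :=
  (isInvertible_opAs a).self_apply_inverse f

theorem inverse_opAs_apply (a : CoerciveFamily V T) (u : SpaceY V T) :
    (opAs a).inverse (opAs a u) = u :=
  (isInvertible_opAs a).inverse_apply_self u

theorem opAs_apply_inverse (a : CoerciveFamily V T) (u : SpaceY V T)
    (f : StrongDual ℝ (SpaceY V T)) : opAs a u ((opAs a).inverse f) = f u := by
  rw [opAs_symm, opAs_inverse_apply]

theorem apply_opAs_inverse_symm (a : CoerciveFamily V T) (f g : StrongDual ℝ (SpaceY V T)) :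
    f ((opAs a).inverse g) = g ((opAs a).inverse f) := by
  rw [← opAs_apply_inverse a ((opAs a).inverse g) f, opAs_inverse_apply]

theorem opBEN_flip (ι : V →L[ℝ] H) (a : CoerciveFamily V T) (tT : Icc (0 : ℝ) T) :
    (opBEN ι a tT).flip = opBEN ι a tT := by
  ext u v
  rw [ContinuousLinearMap.flip_apply, opBEN_apply, opBEN_apply, apply_opAs_inverse_symm,
    opAsTrace_symm]

/-- The quadratic form of the operator controls `‖A_s⁻¹ C u‖` and `‖u‖_Y`, hence also
`∂_t u = C u + A_s u - A u`. -/
theorem isCoercive_opBEN (ι : V →L[ℝ] H) (a : CoerciveFamily V T) (tT : Icc (0 : ℝ) T) :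
    IsCoercive (opBEN ι a tT) := by
  obtain ⟨α, hα, h⟩ := exists_le_opAs_self a
  obtain ⟨k, hk0, hk⟩ := exists_bound_opDt_le ι a
  refine ⟨α / (1 + 2 * k ^ 2), by positivity, fun u => ?_⟩
  obtain ⟨y, hy⟩ : ∃ y, y = (opAs a).inverse (opC ι a u) := ⟨_, rfl⟩
  have hCy : opC ι a u = opAs a y := by rw [hy, opAs_inverse_apply]
  have hform : α * (‖y‖ ^ 2 + ‖embXY ι T u‖ ^ 2) ≤ opBEN ι a tT u u := by
    have h1 := h y
    have h2 := h (embXY ι T u)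
    have h3 := sq_nonneg ‖trace ι T tT u‖
    rw [opBEN_apply, ← hy, hCy, opAsTrace_apply, real_inner_self_eq_norm_sq]
    linarith
  have hder : ‖timeDeriv ι T u‖ ^ 2 ≤ 2 * k ^ 2 * (‖y‖ ^ 2 + ‖embXY ι T u‖ ^ 2) := by
    calc ‖timeDeriv ι T u‖ ^ 2 ≤ (k * (‖y‖ + ‖embXY ι T u‖)) ^ 2 :=
          pow_le_pow_left₀ (norm_nonneg _)
            ((norm_timeDeriv_le_norm_opDt ι u).trans (hk u y hCy)) 2
      _ = k ^ 2 * (‖y‖ + ‖embXY ι T u‖) ^ 2 := mul_pow _ _ _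
      _ ≤ k ^ 2 * (2 * (‖y‖ ^ 2 + ‖embXY ι T u‖ ^ 2)) :=
          mul_le_mul_of_nonneg_left add_sq_le (sq_nonneg k)
      _ = _ := by ring
  rw [mul_assoc, ← sq, div_mul_eq_mul_div, div_le_iff₀ (by positivity)]
  have h1 : ‖u‖ ^ 2 ≤ (1 + 2 * k ^ 2) * (‖y‖ ^ 2 + ‖embXY ι T u‖ ^ 2) := by
    rw [norm_sq_spaceX]
    linarith [sq_nonneg ‖y‖]
  calc α * ‖u‖ ^ 2 ≤ α * ((1 + 2 * k ^ 2) * (‖y‖ ^ 2 + ‖embXY ι T u‖ ^ 2)) :=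
        mul_le_mul_of_nonneg_left h1 hα.le
    _ = α * (‖y‖ ^ 2 + ‖embXY ι T u‖ ^ 2) * (1 + 2 * k ^ 2) := by ring
    _ ≤ _ := mul_le_mul_of_nonneg_right hform (by positivity)

theorem isInvertible_opBEN (ι : V →L[ℝ] H) (a : CoerciveFamily V T) (tT : Icc (0 : ℝ) T) :
    (opBEN ι a tT).IsInvertible :=
  isInvertible_of_isCoercive_of_linearIsometry (isometryX ι T) (isCoercive_opBEN ι a tT)

/-- Elimination of the first unknown: the operator `C' A_s⁻¹ C + A_s + γ_T' γ_T` is the negative of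
the Schur complement of `A_s` in the block operator. -/
theorem opBlock_eq_iff (ι : V →L[ℝ] H) (a : CoerciveFamily V T) (tT : Icc (0 : ℝ) T)
    (lam : SpaceY V T) (u : spaceX ι T) (f : StrongDual ℝ (SpaceY V T))
    (k : StrongDual ℝ (spaceX ι T)) :
    opBlock ι a tT (lam, u) = (f, k) ↔ lam = (opAs a).inverse (f - opC ι a u) ∧
      opBEN ι a tT u = (opC ι a).flip ((opAs a).inverse f) - k := by
  have hBEN : opBEN ι a tT u =
      (opC ι a).flip ((opAs a).inverse (opC ι a u)) + opAsTrace ι a tT u := rfl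
  rw [opBlock_apply, Prod.mk.injEq, hBEN]
  constructor
  · rintro ⟨h1, h2⟩
    have h3 : lam = (opAs a).inverse (f - opC ι a u) := by
      rw [← h1, add_sub_cancel_right, inverse_opAs_apply]
    refine ⟨h3, ?_⟩
    rw [← h2, h3, map_sub, map_sub]
    abel
  · rintro ⟨h1, h2⟩
    refine ⟨by rw [h1, opAs_inverse_apply, sub_add_cancel], ?_⟩
    rw [h1, map_sub, map_sub, sub_sub, h2, sub_sub_cancel]

theorem isInvertible_opBlock (ι : V →L[ℝ] H) (a : CoerciveFamily V T) (tT : Icc (0 : ℝ) T) :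
    (opBlock ι a tT).IsInvertible := by
  have hS := isInvertible_opBEN ι a tT
  have hbij : Function.Bijective (opBlock ι a tT) := by
    refine Function.bijective_iff_existsUnique _ |>.mpr ?_
    rintro ⟨f, k⟩
    obtain ⟨u, hu, huu⟩ := hS.bijective.existsUnique ((opC ι a).flip ((opAs a).inverse f) - k)
    refine ⟨((opAs a).inverse (f - opC ι a u), u), (opBlock_eq_iff ι a tT _ _ _ _).mpr ⟨rfl, hu⟩,
      ?_⟩
    rintro ⟨l, v⟩ hv
    obtain ⟨h1, h2⟩ := (opBlock_eq_iff ι a tT _ _ _ _).mp hv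
    rw [h1, huu v h2]
  exact isInvertible_prod_dual_of_bijective hbij

variable [CompleteSpace H]

theorem opBEN_eq_opSchur (hT : 0 < T) {ι : V →L[ℝ] H} (hι : Function.Injective ι)
    (a : CoerciveFamily V T) {t0 tT : Icc (0 : ℝ) T} (ht0 : (t0 : ℝ) = 0) (htT : (tT : ℝ) = T) :
    opBEN ι a tT = opSchur ι a t0 := by
  ext u v
  have h1 := opDt_add_opDt hT hι ht0 htT u v
  rw [opDt_eq_opC_add ι a, opDt_eq_opC_add ι a] at h1
  simp only [add_apply, sub_apply] at h1
  rw [opBEN_apply, opSchur_apply, opAsTrace_apply, opB_eq_opC_add, opB_eq_opC_add, map_add,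
    inverse_opAs_apply, map_add, add_apply, add_apply, opAs_apply_inverse,
    opAs_symm a (embXY ι T v)]
  rw [opAs_symm a (embXY ι T v), opAs_apply] at h1
  linarith

/-- The equation `(C' A_s⁻¹ C + A_s + γ_T' γ_T) u = (Id + C' A_s⁻¹) g + γ_0' u₀` is the system of
normal equations `B' A_s⁻¹ (B u - g) + γ_0' (γ_0 u - u₀) = 0`; as the range of `(B, γ_0)` is dense,
the residuals vanish. -/
theorem opBEN_eq_iff (hT : 0 < T) {ι : V →L[ℝ] H} (hι : Function.Injective ι)
    (hd : DenseRange ι) (a : CoerciveFamily V T) {t0 tT : Icc (0 : ℝ) T} (ht0 : (t0 : ℝ) = 0)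
    (htT : (tT : ℝ) = T) (g : StrongDual ℝ (SpaceY V T)) (u0 : H) (u : spaceX ι T) :
    opBEN ι a tT u = restrictX ι T g + (opC ι a).flip ((opAs a).inverse g) + traceDual ι T t0 u0 ↔
      opB ι a u = g ∧ trace ι T t0 u = u0 := by
  have hres : ∀ w, opBEN ι a tT u w - (restrictX ι T g + (opC ι a).flip ((opAs a).inverse g)
      + traceDual ι T t0 u0) w = opB ι a w ((opAs a).inverse (opB ι a u - g)) +
        inner ℝ (trace ι T t0 u - u0) (trace ι T t0 w) := by
    intro w
    rw [opBEN_eq_opSchur hT hι a ht0 htT, opSchur_apply, add_apply, add_apply, traceDual_apply,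
      restrictX_apply, ContinuousLinearMap.flip_apply, inner_sub_left, map_sub, map_sub]
    have h1 : opB ι a w ((opAs a).inverse g) =
        opC ι a w ((opAs a).inverse g) + g (embXY ι T w) := by
      rw [opB_eq_opC_add, add_apply, opAs_apply_inverse]
    linarith
  constructor
  · intro h
    obtain ⟨h1, h2⟩ := eq_zero_of_forall_opB_add_inner_eq_zero hT hι hd a ht0 htT
      (lam := (opAs a).inverse (opB ι a u - g)) (h := trace ι T t0 u - u0) fun w => by
        rw [← hres, h, sub_self]
    have h3 := congrArg (opAs a) h1
    rw [opAs_inverse_apply, map_zero] at h3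
    exact ⟨sub_eq_zero.mp h3, sub_eq_zero.mp h2⟩
  · rintro ⟨h1, h2⟩
    ext w
    rw [← sub_eq_zero, hres, h1, h2, sub_self, sub_self, map_zero, map_zero, inner_zero_left,
      add_zero]

theorem opBlock_eq_rhs_iff (hT : 0 < T) {ι : V →L[ℝ] H} (hι : Function.Injective ι)
    (hd : DenseRange ι) (a : CoerciveFamily V T) {t0 tT : Icc (0 : ℝ) T} (ht0 : (t0 : ℝ) = 0)
    (htT : (tT : ℝ) = T) (g : StrongDual ℝ (SpaceY V T)) (u0 : H) (lam : SpaceY V T)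
    (u : spaceX ι T) :
    opBlock ι a tT (lam, u) = (g, -(restrictX ι T g + traceDual ι T t0 u0)) ↔
      lam = embXY ι T u ∧ opB ι a u = g ∧ trace ι T t0 u = u0 := by
  rw [opBlock_eq_iff, ← opBEN_eq_iff hT hι hd a ht0 htT, sub_neg_eq_add, ← add_assoc,
    add_comm ((opC ι a).flip _) (restrictX ι T g)]
  refine and_congr_left fun h => ?_
  rw [← ((opBEN_eq_iff hT hι hd a ht0 htT g u0 u).mp h).1, opB_eq_opC_add, add_sub_cancel_left,
    inverse_opAs_apply]

end Operators

end Parabolic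

end

theorem mainTheorem2 {V H : Type*}
    [NormedAddCommGroup V] [InnerProductSpace ℝ V] [CompleteSpace V]
    [TopologicalSpace.SeparableSpace V]
    [NormedAddCommGroup H] [InnerProductSpace ℝ H] [CompleteSpace H]
    [TopologicalSpace.SeparableSpace H]
    (ι : V →L[ℝ] H) (hι_inj : Function.Injective ι) (hι_dense : DenseRange ι)
    (hι_compact : IsCompactOperator ι)
    (T : ℝ) (hT : 0 < T) (a : Parabolic.CoerciveFamily V T)
    (t0 tT : Set.Icc (0 : ℝ) T) (ht0 : (t0 : ℝ) = 0) (htT : (tT : ℝ) = T) :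
    -- the continuous embedding of `X` into `C([0,T]; H)` exists, so that the traces are genuine,
    Parabolic.IsContEmbedding ι T (Parabolic.contEmb ι T) ∧
    -- `A_s ∈ Lis(Y, Y')`, so that `A_s⁻¹` is genuine,
    (Parabolic.opAs a).IsInvertible ∧
    -- `C' A_s⁻¹ C + A_s + γ_T' γ_T` is self-adjoint, coercive and in `Lis(X, X')`,
    (Parabolic.opBEN ι a tT).flip = Parabolic.opBEN ι a tT ∧
    IsCoercive (Parabolic.opBEN ι a tT) ∧
    (Parabolic.opBEN ι a tT).IsInvertible ∧
    -- it equals the Schur complement `B' A_s⁻¹ B + γ_0' γ_0`,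
    Parabolic.opBEN ι a tT = Parabolic.opSchur ι a t0 ∧
    -- the block operator is self-adjoint and in `Lis(Y × X, Y' × X')`,
    (∀ p q : Parabolic.SpaceY V T × Parabolic.spaceX ι T,
      (Parabolic.opBlock ι a tT p).1 q.1 + (Parabolic.opBlock ι a tT p).2 q.2 =
        (Parabolic.opBlock ι a tT q).1 p.1 + (Parabolic.opBlock ι a tT q).2 p.2) ∧
    (Parabolic.opBlock ι a tT).IsInvertible ∧
    ∀ (g : StrongDual ℝ (Parabolic.SpaceY V T)) (u0 : H),
      -- `(C' A_s⁻¹ C + A_s + γ_T' γ_T) u = (Id + C' A_s⁻¹) g + γ_0' u_0` is uniquely solvable and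
      -- equivalent to `B u = g`, `γ_0 u = u_0`,
      (∃! u : Parabolic.spaceX ι T, Parabolic.opBEN ι a tT u =
        Parabolic.restrictX ι T g + (Parabolic.opC ι a).flip ((Parabolic.opAs a).inverse g)
          + Parabolic.traceDual ι T t0 u0) ∧
      (∀ u : Parabolic.spaceX ι T,
        Parabolic.opBEN ι a tT u =
          Parabolic.restrictX ι T g + (Parabolic.opC ι a).flip ((Parabolic.opAs a).inverse g)
            + Parabolic.traceDual ι T t0 u0 ↔
        Parabolic.opB ι a u = g ∧ Parabolic.trace ι T t0 u = u0) ∧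
      -- the mixed system is uniquely solvable, and its solution `(lam, u)` is the one with
      -- `lam = u`, `B u = g`, `γ_0 u = u_0`
      (∃! p : Parabolic.SpaceY V T × Parabolic.spaceX ι T, Parabolic.opBlock ι a tT p =
        (g, -(Parabolic.restrictX ι T g + Parabolic.traceDual ι T t0 u0))) ∧
      (∀ (lam : Parabolic.SpaceY V T) (u : Parabolic.spaceX ι T),
        Parabolic.opBlock ι a tT (lam, u) =
          (g, -(Parabolic.restrictX ι T g + Parabolic.traceDual ι T t0 u0)) ↔
        lam = Parabolic.embXY ι T u ∧ Parabolic.opB ι a u = g ∧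
          Parabolic.trace ι T t0 u = u0) := by
  have hblock := Parabolic.opBlock_eq_rhs_iff hT hι_inj hι_dense a ht0 htT
  exact ⟨Parabolic.isContEmbedding_contEmb hT hι_inj, Parabolic.isInvertible_opAs a,
    Parabolic.opBEN_flip ι a tT, Parabolic.isCoercive_opBEN ι a tT,
    Parabolic.isInvertible_opBEN ι a tT,
    Parabolic.opBEN_eq_opSchur hT hι_inj a ht0 htT, Parabolic.opBlock_symm ι a tT,
    Parabolic.isInvertible_opBlock ι a tT, fun g u0 =>
    ⟨(Parabolic.isInvertible_opBEN ι a tT).bijective.existsUnique _,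
      Parabolic.opBEN_eq_iff hT hι_inj hι_dense a ht0 htT g u0,
      (Parabolic.isInvertible_opBlock ι a tT).bijective.existsUnique _, hblock g u0⟩⟩
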